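/- Notation. Let $dA$ be area measure on $\mathbb C$ (its normalization is irrelevant below) and $\mathbb D$ the unit disc. A weight on an open set $\Omega\subset\mathbb C$ is a locally integrable, almost everywhere positive function on $\Omega$. For a measurable set $E$ with $0<|E|<\infty$, put $\langle f\rangle_{q,E}=\left(\frac1{|E|}\int_E|f|^q\,dA\right)^{1/q}$ for $0<q<\infty$, $\langle f\rangle_{\infty,E}=\|f\|_{L^\infty(E)}$ and $\langle f\rangle_E=\langle f\rangle_{1,E}$. For an arc $I\subset\mathbb T$ with centre $e^{i\theta_0}$ and arclength $\ell(I)\in(0,1]$, normalized so that $\ell(\mathbb T)=1$, the Carleson box is $$Q_I=\{re^{i\theta}\in\mathbb D:\ 1-r\le \ell(I),\ |\theta-\theta_0|\le \pi\,\ell(I)\}.$$ For $1\le p<\infty$ and a conformal map $\psi$ of $\mathbb D$ onto $\Omega$, put $$[v]_{\mathrm B_p(\mathbb D)}=\sup_I\langle v\rangle_{Q_I}\langle v^{-1}\rangle_{\frac1{p-1},Q_I},\qquad [\sigma]_{\mathrm B_p(\Omega)}=\sup_I\langle\sigma\rangle_{\psi(Q_I)}\langle\sigma^{-1}\rangle_{\frac1{p-1},\psi(Q_I)}$$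 (with $\frac1{p-1}=\infty$ for $p=1$); a weight belongs to the class $\mathrm B_p$ if its characteristic is finite. The Bergman projection $\Pi_\Omega$ is the orthogonal projection of $L^2(\Omega)$ onto its closed subspace of holomorphic functions, and $\|f\|_{L^p(\Omega,\sigma)}=\left(\int_\Omega|f|^p\sigma\,dA\right)^{1/p}$. Theorem 1.1. Let $1<p<\infty$. There is a constant $C_p>0$ depending only on $p$ such that the following holds. Let $\Omega\subset\mathbb C$ be a bounded, simply connected domain, let $\psi$ be a conformal map of $\mathbb D$ onto $\Omega$ with $|\psi'|^2\in\mathrm B_1(\mathbb D)$, and let $\sigma$ be a weight on $\Omega$ with $\sigma\in\mathrm B_p(\Omega)$, where the $\mathrm B_p(\Omega)$ characteristic is formed with this $\psi$. Then the restriction of $\Pi_\Omega$ to $L^2(\Omega)\cap L^p(\Omega,\sigma)$ extends uniquely to a bounded linear operator on $L^p(\Omega,\sigma)$, and $$\|\Pi_\Omega\|_{\mathcal L(L^p(\Omega,\sigma))}\le C_p\left([|\psi'|^2]_{\mathrm B_1(\mathbb D)}^{\,p}\,[\sigma]_{\mathrm B_p(\Omega)}\right)^{\max\{1,\frac1{p-1}\}}.$$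 -/

import Mathlib

open MeasureTheory Metric Set Filter Topology
open scoped ENNReal

noncomputable section

namespace Bekolle

/-! ### The Bergman space and the Bergman projection

Three estimates give that the Bergman space is closed in `L²(Ω)`. -/

theorem enorm_le_circle {g : ℂ → ℂ} {c : ℂ} {r ρ : ℝ} (hg : DifferentiableOn ℂ g (ball c r))
    (h0 : 0 < ρ) (hρ : ρ < r) :
    ENNReal.ofReal (2 * Real.pi) * ‖g c‖ₑ ≤
      ∫⁻ θ in Ioo (-Real.pi) Real.pi, ‖g (c + Complex.polarCoord.symm (ρ, θ))‖ₑ := by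
  have hsub : closedBall c ρ ⊆ ball c r := closedBall_subset_ball hρ
  have hd : DiffContOnCl ℂ g (ball c |ρ|) := by
    rw [abs_of_pos h0]
    exact (hg.mono (by rwa [closure_ball c h0.ne'])).diffContOnCl
  have hm := hd.circleAverage
  have hper : Function.Periodic (fun θ : ℝ => g (circleMap c ρ θ)) (2 * Real.pi) :=
    fun θ => by simp [periodic_circleMap c ρ θ]
  have h1 := hper.intervalIntegral_add_eq 0 (-Real.pi)
  rw [Real.circleAverage, ← zero_add (2 * Real.pi)] at hm
  rw [h1, show -Real.pi + 2 * Real.pi = Real.pi by ring, zero_add,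
    intervalIntegral.integral_of_le (by linarith [Real.pi_pos]),
    integral_Ioc_eq_integral_Ioo] at hm
  have h2 : (∫ θ in Ioo (-Real.pi) Real.pi, g (circleMap c ρ θ)) = (2 * Real.pi : ℝ) • g c := by
    rw [← hm, smul_smul, mul_inv_cancel₀ (by positivity), one_smul]
  have h3 := enorm_integral_le_lintegral_enorm
    (μ := volume.restrict (Ioo (-Real.pi) Real.pi)) (fun θ => g (circleMap c ρ θ))
  rw [h2, enorm_smul, Real.enorm_of_nonneg (by positivity)] at h3
  refine h3.trans (le_of_eq ?_)
  congr 1; ext θ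
  rw [Complex.polarCoord_symm_apply, circleMap, Complex.exp_mul_I]
  simp

theorem enorm_le_lintegral_ball {g : ℂ → ℂ} {c : ℂ} {r : ℝ} (hr : 0 < r)
    (hg : DifferentiableOn ℂ g (ball c r)) :
    ENNReal.ofReal (r / 2) * (ENNReal.ofReal (r / 2) * (ENNReal.ofReal (2 * Real.pi) * ‖g c‖ₑ)) ≤
      ∫⁻ z in ball c r, ‖g z‖ₑ := by
  have e1 : ∫⁻ z in ball c r, ‖g z‖ₑ = ∫⁻ z, (ball c r).indicator (fun z => ‖g z‖ₑ) (c + z) := by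
    rw [lintegral_add_left_eq_self (fun z => (ball c r).indicator (fun z => ‖g z‖ₑ) z) c,
      lintegral_indicator measurableSet_ball]
  rw [e1, ← Complex.lintegral_comp_polarCoord_symm]
  set S : Set (ℝ × ℝ) := Ioo (r / 2) r ×ˢ Ioo (-Real.pi) Real.pi with hS
  have hSm : MeasurableSet S := measurableSet_Ioo.prod measurableSet_Ioo
  have hST : S ⊆ polarCoord.target := by
    rintro ⟨ρ, θ⟩ ⟨h1, h2⟩
    rw [polarCoord_target]
    exact ⟨lt_trans (by positivity) h1.1, h2⟩
  have hin : ∀ q ∈ S, c + Complex.polarCoord.symm q ∈ ball c r := by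
    rintro ⟨ρ, θ⟩ ⟨h1, h2⟩
    have : 0 < ρ := lt_trans (by positivity) h1.1
    simp only [mem_ball, dist_self_add_left, Complex.norm_polarCoord_symm]
    rw [abs_of_pos this]; exact h1.2
  have hcont : ContinuousOn (fun q : ℝ × ℝ => g (c + Complex.polarCoord.symm q)) S := by
    refine hg.continuousOn.comp ?_ hin
    have : Continuous fun q : ℝ × ℝ => c + Complex.polarCoord.symm q := by
      simp only [Complex.polarCoord_symm_apply]; fun_prop
    exact this.continuousOn
  calc _ = ∫⁻ ρ in Ioo (r / 2) r, (ENNReal.ofReal (r / 2) * (ENNReal.ofReal (2 * Real.pi) * ‖g c‖ₑ)) := by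
        rw [setLIntegral_const, Real.volume_Ioo, mul_comm]; congr 2; ring
    _ ≤ ∫⁻ ρ in Ioo (r / 2) r, ∫⁻ θ in Ioo (-Real.pi) Real.pi,
          ENNReal.ofReal (r / 2) * ‖g (c + Complex.polarCoord.symm (ρ, θ))‖ₑ := by
        refine setLIntegral_mono_ae' measurableSet_Ioo (ae_of_all _ fun ρ hρ => ?_)
        rw [lintegral_const_mul' _ _ ENNReal.ofReal_ne_top]
        gcongr
        exact enorm_le_circle hg (lt_trans (by positivity) hρ.1) hρ.2
    _ = ∫⁻ q in S, ENNReal.ofReal (r / 2) * ‖g (c + Complex.polarCoord.symm q)‖ₑ := by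
        rw [hS, Measure.volume_eq_prod, ← Measure.prod_restrict, lintegral_prod]
        rw [Measure.prod_restrict]
        exact ((hcont.enorm).aemeasurable hSm).const_mul _
    _ ≤ ∫⁻ q in S, ENNReal.ofReal q.1 •
          (ball c r).indicator (fun z => ‖g z‖ₑ) (c + Complex.polarCoord.symm q) := by
        refine setLIntegral_mono_ae' hSm (ae_of_all _ fun q hq => ?_)
        rw [indicator_of_mem (hin q hq), smul_eq_mul]
        gcongr
        exact hq.1.1.le
    _ ≤ _ := lintegral_mono_set hST

theorem norm_le_L2 {Ω : Set ℂ} {r : ℝ} (hr : 0 < r) :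
    ∃ C : ℝ, 0 < C ∧ ∀ (g : ℂ → ℂ) (c : ℂ) (F : Lp ℂ 2 (volume.restrict Ω)), DifferentiableOn ℂ g (ball c r) → ball c r ⊆ Ω → F =ᵐ[volume.restrict Ω] g → ‖g c‖ ≤ C * ‖F‖ := by
  set A : ℝ≥0∞ := ENNReal.ofReal (r / 2) * (ENNReal.ofReal (r / 2) * ENNReal.ofReal (2 * Real.pi)) with hA
  set B : ℝ≥0∞ := volume (ball (0:ℂ) r) ^ (1 / (1:ℝ≥0∞).toReal - 1 / (2:ℝ≥0∞).toReal) with hB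
  have hpi := Real.pi_pos
  have hA0 : A ≠ 0 := by
    rw [hA]; simp [hr, hpi]
  have hAt : A ≠ ⊤ := by
    rw [hA]; finiteness
  have hBt : B ≠ ⊤ := by
    rw [hB]
    exact ENNReal.rpow_ne_top_of_nonneg (by norm_num) measure_ball_lt_top.ne
  refine ⟨(B / A).toReal + 1, by positivity, fun g c F hg hsub hF => ?_⟩
  have h1 := enorm_le_lintegral_ball hr hg
  have hae : F =ᵐ[volume.restrict (ball c r)] g := ae_restrict_of_ae_restrict_of_subset hsub hF
  have h2 : ∫⁻ z in ball c r, ‖g z‖ₑ ≤ ‖F‖ₑ * B := by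
    have : ∫⁻ z in ball c r, ‖g z‖ₑ = eLpNorm F 1 (volume.restrict (ball c r)) := by
      rw [eLpNorm_congr_ae hae, eLpNorm_one_eq_lintegral_enorm]
    rw [this]
    refine (eLpNorm_le_eLpNorm_mul_rpow_measure_univ (p := 1) (q := 2) (by norm_num)
      ((Lp.aestronglyMeasurable F).mono_measure (Measure.restrict_mono hsub le_rfl))).trans ?_
    rw [Measure.restrict_apply_univ, Lp.enorm_def, hB, Complex.volume_ball, Complex.volume_ball]
    gcongr
  have h3 : ‖g c‖ₑ ≤ B / A * ‖F‖ₑ := by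
    have : ‖g c‖ₑ * A ≤ ‖F‖ₑ * B := by
      refine le_trans (le_of_eq ?_) (h1.trans h2); rw [hA]; ring
    rw [← ENNReal.le_div_iff_mul_le (Or.inl hA0) (Or.inl hAt)] at this
    refine this.trans (le_of_eq ?_)
    rw [div_eq_mul_inv, div_eq_mul_inv]; ring
  have h4 := ENNReal.toReal_mono (by finiteness) h3
  rw [ENNReal.toReal_mul, toReal_enorm, toReal_enorm] at h4
  nlinarith [norm_nonneg F]

/-- The Bergman space of `Ω`: the elements of `L²(Ω)` that have a holomorphic representative. -/
def bergmanSpace (Ω : TopologicalSpace.Opens ℂ) :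
    Submodule ℂ (Lp ℂ 2 (volume.restrict (Ω : Set ℂ))) where
  carrier := {f | ∃ g : ℂ → ℂ, DifferentiableOn ℂ g Ω ∧ f =ᵐ[volume.restrict (Ω : Set ℂ)] g}
  zero_mem' := ⟨0, differentiableOn_const 0, Lp.coeFn_zero ℂ 2 _⟩
  add_mem' := by
    rintro f₁ f₂ ⟨g₁, hg₁, h₁⟩ ⟨g₂, hg₂, h₂⟩
    exact ⟨g₁ + g₂, hg₁.add hg₂, (Lp.coeFn_add f₁ f₂).trans (h₁.add h₂)⟩
  smul_mem' := by
    rintro a f ⟨g, hg, h⟩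
    exact ⟨a • g, hg.const_smul a, (Lp.coeFn_smul a f).trans (h.const_smul a)⟩

theorem isClosed_bergmanSpace (Ω : TopologicalSpace.Opens ℂ) :
    IsClosed (bergmanSpace Ω : Set (Lp ℂ 2 (volume.restrict (Ω : Set ℂ)))) := by
  refine IsSeqClosed.isClosed fun f F hf hlim => ?_
  choose g hg hfg using hf
  have key : ∀ z ∈ (Ω : Set ℂ), ∃ t ∈ 𝓝[Ω] z, UniformCauchySeqOn g atTop t := by
    intro z hz
    obtain ⟨r, hr, hsub⟩ := Metric.isOpen_iff.1 Ω.isOpen z hz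
    obtain ⟨C, hC, hb⟩ := norm_le_L2 (Ω := (Ω : Set ℂ)) (half_pos hr)
    refine ⟨ball z (r / 2), mem_nhdsWithin_of_mem_nhds (ball_mem_nhds z (half_pos hr)), ?_⟩
    rw [Metric.uniformCauchySeqOn_iff]
    intro ε hε
    obtain ⟨N, hN⟩ := Metric.cauchySeq_iff.1 hlim.cauchySeq (ε / C) (by positivity)
    refine ⟨N, fun m hm n hn x hx => ?_⟩
    have hbx : ball x (r / 2) ⊆ (Ω : Set ℂ) := by
      refine subset_trans (fun y hy => ?_) hsub
      rw [mem_ball] at *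
      linarith [dist_triangle y x z]
    have := hb (g m - g n) x (f m - f n) (((hg m).sub (hg n)).mono hbx) hbx
      ((Lp.coeFn_sub _ _).trans ((hfg m).sub (hfg n)))
    have h2 := hN m hm n hn
    rw [dist_eq_norm] at h2 ⊢
    rw [lt_div_iff₀ hC] at h2
    simp only [Pi.sub_apply] at this
    linarith
  have hpt : ∀ z ∈ (Ω : Set ℂ), ∃ l, Tendsto (fun n => g n z) atTop (𝓝 l) := by
    intro z hz
    obtain ⟨t, ht, hu⟩ := key z hz
    exact cauchySeq_tendsto_of_complete (hu.cauchySeq (mem_of_mem_nhdsWithin hz ht))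
  choose! G hG using hpt
  have hloc : TendstoLocallyUniformlyOn g G atTop (Ω : Set ℂ) := by
    intro u hu z hz
    obtain ⟨t, ht, hc⟩ := key z hz
    have ht' : t ∩ Ω ∈ 𝓝[Ω] z := inter_mem ht self_mem_nhdsWithin
    exact ⟨t ∩ Ω, ht', (hc.mono inter_subset_left).tendstoUniformlyOn_of_tendsto
      (fun x hx => hG x hx.2) u hu⟩
  refine ⟨G, hloc.differentiableOn (Eventually.of_forall hg) Ω.isOpen, ?_⟩
  obtain ⟨ns, hns, hae⟩ := (tendstoInMeasure_of_tendsto_Lp hlim).exists_seq_tendsto_ae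
  have hall : ∀ᵐ z ∂volume.restrict (Ω : Set ℂ), ∀ n, f n z = g n z := ae_all_iff.2 hfg
  filter_upwards [hae, hall, ae_restrict_mem Ω.isOpen.measurableSet] with z h1 h2 hz
  refine tendsto_nhds_unique h1 ?_
  simp only [h2]
  exact (hG z hz).comp hns.tendsto_atTop

instance hasOrthogonalProjection_bergmanSpace (Ω : TopologicalSpace.Opens ℂ) : (bergmanSpace Ω).HasOrthogonalProjection := by
  have : CompleteSpace (bergmanSpace Ω) := (isClosed_bergmanSpace Ω).completeSpace_coe
  infer_instance

/-- The Bergman projection of `Ω`: the orthogonal projection of `L²(Ω)` onto its Bergman space. -/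
def bergmanProjection (Ω : TopologicalSpace.Opens ℂ) :
    Lp ℂ 2 (volume.restrict (Ω : Set ℂ)) →L[ℂ] Lp ℂ 2 (volume.restrict (Ω : Set ℂ)) :=
  (bergmanSpace Ω).starProjection

/-! ### Weights and Békollè–Bonami characteristics -/

/-- A weight on `Ω`: a locally integrable, almost everywhere positive function. -/
def IsWeight (Ω : Set ℂ) (σ : ℂ → ℝ) : Prop :=
  LocallyIntegrableOn σ Ω ∧ ∀ᵐ z ∂volume.restrict Ω, 0 < σ z

/-- The Carleson box over the arc of the unit circle with centre `exp (i θ₀)` and normalized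
length `s` (the whole circle has length `1`, so the arc is `|θ - θ₀| ≤ π s`). -/
def carlesonBox (θ₀ s : ℝ) : Set ℂ :=
  {z | ‖z‖ < 1 ∧ ∃ r θ : ℝ, 0 ≤ r ∧ z = r * Complex.exp (θ * Complex.I) ∧
    1 - r ≤ s ∧ |θ - θ₀| ≤ Real.pi * s}

/-- The local average `(⨍_E |f|^q)^{1/q}`; for `q = ∞` it is the `L^∞(E)` norm, since then
`1 / q.toReal = 0`. -/
def localAverage (q : ℝ≥0∞) (f : ℂ → ℝ) (E : Set ℂ) : ℝ≥0∞ :=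
  eLpNorm f q (volume.restrict E) / volume E ^ (1 / q.toReal)

/-- The product `⟨σ⟩_E ⟨σ⁻¹⟩_{1/(p-1), E}`; for `p = 1` the exponent `1/(p-1)` is `∞`. -/
def bekolleProduct (p : ℝ) (σ : ℂ → ℝ) (E : Set ℂ) : ℝ≥0∞ :=
  localAverage 1 σ E * localAverage (ENNReal.ofReal (p - 1))⁻¹ (fun z => (σ z)⁻¹) E

/-- The characteristic `[σ]_{B_p(𝔻)}`. -/
def diskChar (p : ℝ) (σ : ℂ → ℝ) : ℝ≥0∞ :=
  ⨆ (θ₀ : ℝ) (s : ℝ) (_ : 0 < s ∧ s ≤ 1), bekolleProduct p σ (carlesonBox θ₀ s)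

/-- The characteristic `[σ]_{B_p(Ω)}` for `Ω = ψ(𝔻)`: the supremum is over the images `ψ(Q_I)`. -/
def domainChar (ψ : ℂ → ℂ) (p : ℝ) (σ : ℂ → ℝ) : ℝ≥0∞ :=
  ⨆ (θ₀ : ℝ) (s : ℝ) (_ : 0 < s ∧ s ≤ 1), bekolleProduct p σ (ψ '' carlesonBox θ₀ s)

/-- `ψ` is a conformal (holomorphic and bijective) map of the unit disk onto `Ω`. -/
def IsConformalOnto (ψ : ℂ → ℂ) (Ω : Set ℂ) : Prop :=
  DifferentiableOn ℂ ψ (ball 0 1) ∧ BijOn ψ (ball 0 1) Ω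

/-- The measure `σ dA` on `Ω`, so that `L^p(Ω, σ)` is `Lp ℂ p (weightedMeasure Ω σ)`. -/
def weightedMeasure (Ω : Set ℂ) (σ : ℂ → ℝ) : Measure ℂ :=
  (volume.restrict Ω).withDensity fun z => ENNReal.ofReal (σ z)

/-- The bounded operator `T` on `L^p(Ω, σ)` agrees with the Bergman projection on
`L²(Ω) ∩ L^p(Ω, σ)`. -/
def ExtendsBergman (Ω : TopologicalSpace.Opens ℂ) (p : ℝ≥0∞) [Fact (1 ≤ p)] (σ : ℂ → ℝ)
    (T : Lp ℂ p (weightedMeasure Ω σ) →L[ℂ] Lp ℂ p (weightedMeasure Ω σ)) : Prop :=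
  ∀ (f : ℂ → ℂ) (h₂ : MemLp f 2 (volume.restrict (Ω : Set ℂ)))
    (hp : MemLp f p (weightedMeasure Ω σ)),
    T (hp.toLp f) =ᵐ[volume.restrict (Ω : Set ℂ)] bergmanProjection Ω (h₂.toLp f)

end Bekolle

end

noncomputable section

namespace Bekolle

/-! The map `f ↦ (f ∘ ψ) ψ'` carries the Bergman projection of `Ω` to that of the disk, and `L^p(Ω,
σ)` to `L^p(𝔻, ω)` with `ω = (σ ∘ ψ) |ψ'|^(2-p)`. Testing against the transported kernel and using
its reproducing property (`integral_mul_kernel`) shows that the projection is dominated pointwise by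
the positive operator with kernel `|1 - z w̄|⁻²` (`enorm_bergmanProjection_le`). Two facts then
remain to be proved.

The first concerns the weight: on a Carleson box `E`, `|ψ'|⁻²` is at most its essential supremum
`κ`, and this costs `κ^(p/2)` in the integral of `ω` and again in that of its dual weight. Together
with `(|ψ(E)| / |E|)^p`, which comes from the change of normalization, this makes up the factor
`[|ψ'|²]_{B_1}^p` (`weight_product_le`).

The second is a sharp estimate on the disk (`exists_disk_estimate`). Two points `z`, `w` always
share a box of side comparable to `|1 - z w̄|` in one of two dyadic grids (`absKernel_le`), so the
kernel is dominated by two sums over nested boxes. The top halves of the boxes are disjoint and have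
area comparable to that of the boxes, so the sums are sparse. By duality one bounds a bilinear form.
Its averages are taken with respect to the weighted measures themselves, and then the `B_p`
condition, Hölder on the tops and the Carleson embedding theorem for each measure suffice
(`sparseForm_le`). The characteristic enters to the power `1` if `p ≥ 2`, and exchanging the two
measures gives `1/(p-1)` if `p ≤ 2`.

The a priori bound on `L²(Ω)` finally extends by density of simple functions
(`exists_extendsBergman`). -/

/-! ### Nested families of boxes -/

/-- A family of measurable boxes with a generation function, such that two boxes that meet are
nested; each box has a distinguished top part, and the top parts are disjoint. -/
structure NestedFamily (X ι : Type*) [MeasurableSpace X] where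
  box : ι → Set X
  top : ι → Set X
  gen : ι → ℕ
  measurableSet_box : ∀ i, MeasurableSet (box i)
  measurableSet_top : ∀ i, MeasurableSet (top i)
  top_subset : ∀ i, top i ⊆ box i
  disjoint_top : Pairwise fun i j => Disjoint (top i) (top j)
  nested : ∀ i j, gen i ≤ gen j → (box i ∩ box j).Nonempty → box j ⊆ box i
  eq_of_gen_eq : ∀ i j, gen i = gen j → (box i ∩ box j).Nonempty → i = j

/-- The layer-cake formula for one number, that is, for a constant function and a Dirac mass; the
value `⊤` follows by monotonicity. It expands powers of averages into level sets. -/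
theorem lintegral_layer {q : ℝ} (hq : 0 < q) (a : ℝ≥0∞) :
    ENNReal.ofReal q * ∫⁻ t in Ioi (0 : ℝ),
      (if ENNReal.ofReal t < a then ENNReal.ofReal (t ^ (q - 1)) else 0) = a ^ q := by
  have key : ∀ b : ℝ, 0 ≤ b → ENNReal.ofReal q * ∫⁻ t in Ioi (0 : ℝ),
      (if ENNReal.ofReal t < ENNReal.ofReal b then ENNReal.ofReal (t ^ (q - 1)) else 0)
        = ENNReal.ofReal b ^ q := by
    intro b hb
    have := lintegral_rpow_eq_lintegral_meas_lt_mul (Measure.dirac (0 : ℝ))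
      (f := fun _ => b) (ae_of_all _ fun _ => hb) aemeasurable_const hq
    rw [lintegral_const, measure_univ, mul_one] at this
    rw [ENNReal.ofReal_rpow_of_nonneg hb hq.le, this]
    congr 1
    refine setLIntegral_congr_fun measurableSet_Ioi fun t ht => ?_
    have ht0 : (0 : ℝ) ≤ t := le_of_lt ht
    by_cases h : t < b
    · simp [h, ht0.trans_lt h]
    · simp [ENNReal.ofReal_lt_ofReal_iff', h]
  by_cases ha : a = ⊤
  · subst ha
    rw [ENNReal.top_rpow_of_pos hq]
    refine ENNReal.eq_top_of_forall_nnreal_le fun r => ?_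
    set b : ℝ := (r : ℝ) ^ q⁻¹
    have hb : 0 ≤ b := by positivity
    have h1 := key b hb
    have h2 : ENNReal.ofReal b ^ q = r := by
      rw [ENNReal.ofReal_rpow_of_nonneg hb hq.le, show b = (r : ℝ) ^ q⁻¹ from rfl, ← Real.rpow_mul r.coe_nonneg, inv_mul_cancel₀ hq.ne',
        Real.rpow_one, ENNReal.ofReal_coe_nnreal]
    rw [← h2, ← h1]
    gcongr with t
    split_ifs <;> simp_all
  · rw [← ENNReal.ofReal_toReal ha]
    exact key _ ENNReal.toReal_nonneg

namespace NestedFamily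

variable {X ι : Type*} [MeasurableSpace X] [Countable ι] (F : NestedFamily X ι)

/-- Selected boxes of minimal generation are pairwise disjoint and cover all the others, so the
inequality can be summed over them. No doubling of `μ` is involved. -/
theorem weak_type (μ : Measure X) (φ : X → ℝ≥0∞) (t : ℝ≥0∞) :
    t * μ (⋃ i ∈ {i | t * μ (F.box i) < ∫⁻ x in F.box i, φ x ∂μ}, F.box i) ≤ ∫⁻ x, φ x ∂μ := by
  set S : Set ι := {i | t * μ (F.box i) < ∫⁻ x in F.box i, φ x ∂μ} with hS
  set M : Set ι := {i | i ∈ S ∧ ∀ j, F.gen j < F.gen i → (F.box i ∩ F.box j).Nonempty → j ∉ S}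
  have hcover : (⋃ i ∈ S, F.box i) ⊆ ⋃ i ∈ M, F.box i := by
    intro x hx
    simp only [mem_iUnion] at hx ⊢
    obtain ⟨i, hi, hxi⟩ := hx
    have hex : ∃ n, ∃ j ∈ S, x ∈ F.box j ∧ F.gen j = n := ⟨_, i, hi, hxi, rfl⟩
    classical
    obtain ⟨j, hj, hxj, hjn⟩ := Nat.find_spec hex
    refine ⟨j, ⟨hj, fun j' hlt hne hj' => ?_⟩, hxj⟩
    rw [inter_comm] at hne
    have : x ∈ F.box j' := F.nested j' j hlt.le hne hxj
    exact Nat.find_min hex (hjn ▸ hlt) ⟨j', hj', this, rfl⟩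
  have hdisj : M.PairwiseDisjoint F.box := by
    intro i hi j hj hij
    by_contra h
    rw [Function.onFun, Set.not_disjoint_iff_nonempty_inter] at h
    rcases lt_trichotomy (F.gen i) (F.gen j) with hlt | heq | hlt
    · exact hj.2 i hlt (inter_comm _ _ ▸ h) hi.1
    · exact hij (F.eq_of_gen_eq i j heq h)
    · exact hi.2 j hlt h hj.1
  have hMc : M.Countable := M.to_countable
  calc t * μ (⋃ i ∈ S, F.box i) ≤ t * μ (⋃ i ∈ M, F.box i) := by gcongr
    _ = t * ∑' i : M, μ (F.box i) := by
        rw [measure_biUnion hMc hdisj fun i _ => F.measurableSet_box i]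
    _ = ∑' i : M, t * μ (F.box i) := ENNReal.tsum_mul_left.symm
    _ ≤ ∑' i : M, ∫⁻ x in F.box i, φ x ∂μ := ENNReal.tsum_le_tsum fun i => i.2.1.le
    _ = ∫⁻ x in ⋃ i ∈ M, F.box i, φ x ∂μ :=
        (lintegral_biUnion hMc (fun i _ => F.measurableSet_box i) hdisj φ).symm
    _ ≤ ∫⁻ x, φ x ∂μ := setLIntegral_le_lintegral _ _

/-- The average of `φ` over a box. -/
def avg (μ : Measure X) (φ : X → ℝ≥0∞) (i : ι) : ℝ≥0∞ :=
  (∫⁻ x in F.box i, φ x ∂μ) / μ (F.box i)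

/-- The part of `φ` below `t/2` adds at most `t/2` to any average, so an average above `t` forces
the remaining part `φ₁` to have average above `t/2`. The tops are disjoint and lie in the union of
these boxes, to which `weak_type` applies. -/
theorem tsum_top_le (μ : Measure X) [IsFiniteMeasure μ] (φ : X → ℝ≥0∞) {t : ℝ}
    (ht : 0 < t) :
    ∑' i, (if ENNReal.ofReal t < F.avg μ φ i then μ (F.top i) else 0) ≤
      ENNReal.ofReal (2 / t) * ∫⁻ x, (if ENNReal.ofReal t < 2 * φ x then φ x else 0) ∂μ := by
  set s := ENNReal.ofReal (t / 2) with hs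
  have hs0 : s ≠ 0 := by simp [hs, ht]
  have hst : ENNReal.ofReal t = 2 * s := by
    rw [hs, ← ENNReal.ofReal_ofNat, ← ENNReal.ofReal_mul (by norm_num)]; congr 1; ring
  set φ₁ : X → ℝ≥0∞ := fun x => if ENNReal.ofReal t < 2 * φ x then φ x else 0 with hφ₁
  have hle : ∀ x, φ x ≤ φ₁ x + s := by
    intro x
    simp only [hφ₁]
    split_ifs with h
    · exact le_self_add
    · rw [hst, not_lt] at h
      rw [zero_add]
      exact (ENNReal.mul_le_mul_iff_right two_ne_zero ENNReal.ofNat_ne_top).1 h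
  set S : Set ι := {i | s * μ (F.box i) < ∫⁻ x in F.box i, φ₁ x ∂μ} with hS
  have hmem : ∀ i, ENNReal.ofReal t < F.avg μ φ i → i ∈ S := by
    intro i hi
    by_contra hcon
    simp only [hS, mem_ofPred_eq, not_lt] at hcon
    refine hi.not_ge (ENNReal.div_le_of_le_mul ?_)
    calc ∫⁻ x in F.box i, φ x ∂μ ≤ ∫⁻ x in F.box i, (φ₁ x + s) ∂μ := lintegral_mono fun x => hle x
      _ = ∫⁻ x in F.box i, φ₁ x ∂μ + s * μ (F.box i) := by
        rw [lintegral_add_right _ measurable_const, setLIntegral_const]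
      _ ≤ s * μ (F.box i) + s * μ (F.box i) := by gcongr
      _ = _ := by rw [hst]; ring
  have h1 : ∑' i, (if ENNReal.ofReal t < F.avg μ φ i then μ (F.top i) else 0) ≤
      μ (⋃ i ∈ S, F.box i) := by
    calc _ ≤ ∑' i, S.indicator (fun i => μ (F.top i)) i := by
          refine ENNReal.tsum_le_tsum fun i => ?_
          split_ifs with h
          · rw [indicator_of_mem (hmem i h)]
          · exact zero_le
      _ = ∑' i : S, μ (F.top i) := (tsum_subtype S fun i => μ (F.top i)).symm
      _ = μ (⋃ i ∈ S, F.top i) := (measure_biUnion S.to_countable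
            (fun i _ j _ hij => F.disjoint_top hij) fun i _ => F.measurableSet_top i).symm
      _ ≤ _ := measure_mono (iUnion₂_mono fun i _ => F.top_subset i)
  have h2 := F.weak_type μ φ₁ s
  refine h1.trans ?_
  rw [show ENNReal.ofReal (2 / t) = s⁻¹ by
    rw [hs, ← ENNReal.ofReal_inv_of_pos (by positivity), inv_div]]
  calc _ = s⁻¹ * (s * μ (⋃ i ∈ S, F.box i)) := by
        rw [← mul_assoc, ENNReal.inv_mul_cancel hs0 ENNReal.ofReal_ne_top, one_mul]
    _ ≤ _ := by gcongr

/-- The Carleson embedding theorem for the family. -/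
theorem carleson_embedding {p : ℝ} (hp : 1 < p) (μ : Measure X) [IsFiniteMeasure μ]
    {φ : X → ℝ≥0∞} (hφ : Measurable φ) :
    ∑' i, F.avg μ φ i ^ p * μ (F.top i) ≤
      ENNReal.ofReal (2 ^ p * (p / (p - 1))) * ∫⁻ x, φ x ^ p ∂μ := by
  have hp0 : 0 < p := by linarith
  have hp1 : 0 < p - 1 := by linarith
  have e1 : ∀ i, F.avg μ φ i ^ p * μ (F.top i) = ENNReal.ofReal p * ∫⁻ t in Ioi (0 : ℝ),
      ENNReal.ofReal (t ^ (p - 1)) *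
        (if ENNReal.ofReal t < F.avg μ φ i then μ (F.top i) else 0) := by
    intro i
    rw [← lintegral_layer hp0 (F.avg μ φ i), mul_assoc, ← lintegral_mul_const' _ _ (measure_ne_top _ _)]
    congr 2; ext t; split_ifs <;> simp
  have hm : ∀ c : ℝ≥0∞, MeasurableSet {t : ℝ | ENNReal.ofReal t < c} := fun c =>
    measurableSet_lt ENNReal.measurable_ofReal measurable_const
  calc ∑' i, F.avg μ φ i ^ p * μ (F.top i)
      = ENNReal.ofReal p * ∫⁻ t in Ioi (0 : ℝ), ENNReal.ofReal (t ^ (p - 1)) *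
        ∑' i, (if ENNReal.ofReal t < F.avg μ φ i then μ (F.top i) else 0) := by
        simp_rw [e1, ENNReal.tsum_mul_left]
        rw [← lintegral_tsum]
        · simp_rw [ENNReal.tsum_mul_left]
        · intro i
          refine (Measurable.mul (by fun_prop) ?_).aemeasurable
          exact Measurable.ite (hm _) measurable_const measurable_const
    -- Marcinkiewicz interpolation: insert the weak-type bound at each level `t`, then exchange the
    -- integrals; the inner one is a layer-cake integral with exponent `p - 1`.
    _ ≤ ENNReal.ofReal p * ∫⁻ t in Ioi (0 : ℝ), ENNReal.ofReal (t ^ (p - 1)) *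
        (ENNReal.ofReal (2 / t) * ∫⁻ x, (if ENNReal.ofReal t < 2 * φ x then φ x else 0) ∂μ) := by
        refine mul_le_mul_right ?_ _
        refine setLIntegral_mono_ae' measurableSet_Ioi (ae_of_all _ fun t ht => ?_)
        gcongr
        exact F.tsum_top_le μ φ ht
    _ = ENNReal.ofReal p * ∫⁻ t in Ioi (0 : ℝ), ∫⁻ x, 2 * φ x *
        (if ENNReal.ofReal t < 2 * φ x then ENNReal.ofReal (t ^ (p - 1 - 1)) else 0) ∂μ := by
        congr 1
        refine setLIntegral_congr_fun measurableSet_Ioi fun t ht => ?_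
        have ht0 : (0 : ℝ) < t := ht
        rw [← mul_assoc, ← ENNReal.ofReal_mul (by positivity), ← lintegral_const_mul' _ _ ENNReal.ofReal_ne_top]
        refine lintegral_congr fun x => ?_
        split_ifs
        · rw [show t ^ (p - 1) * (2 / t) = 2 * t ^ (p - 1 - 1) by
            rw [Real.rpow_sub_one ht0.ne' (p - 1)]; ring, ENNReal.ofReal_mul (by norm_num),
            ENNReal.ofReal_ofNat]
          ring
        · simp
    _ = ENNReal.ofReal p * ∫⁻ x, (∫⁻ t in Ioi (0 : ℝ), 2 * φ x *
        (if ENNReal.ofReal t < 2 * φ x then ENNReal.ofReal (t ^ (p - 1 - 1)) else 0)) ∂μ := by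
        rw [lintegral_lintegral_swap]
        refine Measurable.aemeasurable ?_
        refine Measurable.mul (by fun_prop) (Measurable.ite ?_ (by fun_prop) measurable_const)
        exact measurableSet_lt (by fun_prop) (by fun_prop)
    _ = ENNReal.ofReal p * ∫⁻ x, ENNReal.ofReal (2 ^ p / (p - 1)) * φ x ^ p ∂μ := by
        congr 1
        refine lintegral_congr fun x => ?_
        have hms : Measurable fun t : ℝ =>
            (if ENNReal.ofReal t < 2 * φ x then ENNReal.ofReal (t ^ (p - 1 - 1)) else 0) :=
          Measurable.ite (hm _) (by fun_prop) measurable_const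
        have hl := lintegral_layer hp1 (2 * φ x)
        rw [lintegral_const_mul _ hms]
        have h3 : ∫⁻ t in Ioi (0 : ℝ),
            (if ENNReal.ofReal t < 2 * φ x then ENNReal.ofReal (t ^ (p - 1 - 1)) else 0) =
            ENNReal.ofReal (p - 1)⁻¹ * (2 * φ x) ^ (p - 1) := by
          rw [← hl, ← mul_assoc, ← ENNReal.ofReal_mul (by positivity), inv_mul_cancel₀ hp1.ne']
          simp
        rw [h3]
        have h4 : (2 * φ x) ^ p = 2 * φ x * (2 * φ x) ^ (p - 1) := by
          conv_lhs => rw [show p = 1 + (p - 1) by ring]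
          rw [ENNReal.rpow_add_of_nonneg _ _ zero_le_one hp1.le, ENNReal.rpow_one]
        have h5 : ENNReal.ofReal (2 ^ p / (p - 1)) = ENNReal.ofReal (p - 1)⁻¹ * 2 ^ p := by
          rw [div_eq_mul_inv, mul_comm, ENNReal.ofReal_mul (by positivity),
            ← ENNReal.ofReal_rpow_of_pos two_pos, ENNReal.ofReal_ofNat]
        rw [h5, mul_assoc (ENNReal.ofReal _) (2 ^ p), ← ENNReal.mul_rpow_of_nonneg _ _ hp0.le, h4]
        ring
    _ = _ := by
        rw [lintegral_const_mul _ (by fun_prop), ← mul_assoc, ← ENNReal.ofReal_mul hp0.le]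
        congr 2; ring

end NestedFamily


/-! ### The sharp two-weight bound for the sparse form. -/

theorem tsum_mul_le_Lp_mul_Lq {ι : Type*} {p q : ℝ} (hpq : p.HolderConjugate q) (f g : ι → ℝ≥0∞) :
    ∑' i, f i * g i ≤ (∑' i, f i ^ p) ^ (1 / p) * (∑' i, g i ^ q) ^ (1 / q) := by
  rw [ENNReal.tsum_eq_iSup_sum]
  refine iSup_le fun s => (ENNReal.inner_le_Lp_mul_Lq s f g hpq).trans ?_
  have hp := hpq.nonneg
  have hq := hpq.symm.nonneg
  gcongr <;> exact ENNReal.sum_le_tsum s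

namespace NestedFamily

variable {X ι : Type*} [MeasurableSpace X] [Countable ι] (F : NestedFamily X ι)

/-- The elementary inequality behind the sharp exponent. -/
theorem inv_mul_mul_le {p q : ℝ} (hpq : p.HolderConjugate q) (hp2 : 2 ≤ p)
    {A B m W S w s : ℝ≥0∞} (hm0 : m ≠ 0) (hmt : m ≠ ⊤) (hSt : S ≠ ⊤) (hWt : W ≠ ⊤)
    (hs : s ≤ S) (hw : w ≤ W) (hB : W * S ^ (p - 1) ≤ B * m ^ p)
    (hA : m ≤ A * (w ^ (1 / p) * s ^ (1 / q))) :
    m⁻¹ * (S * W) ≤ B * A ^ (p - 1) * (s ^ (1 / p) * w ^ (1 / q)) := by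
  have hp0 : 0 < p := hpq.pos
  have hq0 : 0 < q := hpq.symm.pos
  have hp1 : 0 < p - 1 := hpq.sub_one_pos
  have hs0 : s ≠ 0 := by
    rintro rfl
    rw [ENNReal.zero_rpow_of_pos (by positivity)] at hA
    simp [hm0] at hA
  have hw0 : w ≠ 0 := by
    rintro rfl
    rw [ENNReal.zero_rpow_of_pos (by positivity)] at hA
    simp [hm0] at hA
  have hst : s ≠ ⊤ := ne_top_of_le_ne_top hSt hs
  have hwt : w ≠ ⊤ := ne_top_of_le_ne_top hWt hw
  have hS0 : S ≠ 0 := fun h => hs0 (le_zero_iff.1 (h ▸ hs))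
  have e1 : S = S ^ (p - 1) * S ^ (2 - p) := by
    rw [← ENNReal.rpow_add _ _ hS0 hSt, show p - 1 + (2 - p) = 1 by ring, ENNReal.rpow_one]
  have e2 : m⁻¹ * m ^ p = m ^ (p - 1) := by
    rw [← ENNReal.rpow_neg_one, ← ENNReal.rpow_add _ _ hm0 hmt]; congr 1; ring
  -- The exponent `2 - p` is nonpositive, so passing from the mass of the box to the smaller mass of
  -- its top goes in the right direction. This is where `2 ≤ p` is needed.
  have e3 : S ^ (2 - p) ≤ s ^ (2 - p) := by
    rw [show 2 - p = -(p - 2) by ring, ENNReal.rpow_neg, ENNReal.rpow_neg]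
    exact ENNReal.inv_le_inv.2 (ENNReal.rpow_le_rpow hs (by linarith))
  have x1 : 1 / p * (p - 1) = 1 / q := by
    have := hpq.inv_add_inv_eq_one
    field_simp at this ⊢
    nlinarith
  have x2 : 1 / q * (p - 1) + (2 - p) = 1 / p := by
    have h : q = p / (p - 1) := hpq.conjugate_eq
    rw [h]; field_simp; ring
  calc m⁻¹ * (S * W) = m⁻¹ * (W * S ^ (p - 1)) * S ^ (2 - p) := by
        conv_lhs => rw [e1]
        ring
    _ ≤ m⁻¹ * (B * m ^ p) * s ^ (2 - p) := by gcongr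
    _ = B * m ^ (p - 1) * s ^ (2 - p) := by rw [← e2]; ring
    _ ≤ B * (A * (w ^ (1 / p) * s ^ (1 / q))) ^ (p - 1) * s ^ (2 - p) := by gcongr
    _ = B * A ^ (p - 1) * (s ^ (1 / p) * w ^ (1 / q)) := by
        rw [ENNReal.mul_rpow_of_nonneg _ _ hp1.le, ENNReal.mul_rpow_of_nonneg _ _ hp1.le,
          ← ENNReal.rpow_mul, ← ENNReal.rpow_mul, x1]
        have : s ^ (1 / q * (p - 1)) * s ^ (2 - p) = s ^ (1 / p) := by
          rw [← ENNReal.rpow_add _ _ hs0 hst, x2]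
        rw [← this]; ring

/-- The constant of the Carleson embedding theorem. -/
def embeddingConst (p : ℝ) : ℝ≥0∞ := ENNReal.ofReal (2 ^ p * (p / (p - 1))) ^ (1 / p)

/-- Each integral is an average times the mass of the box. `inv_mul_mul_le` trades the masses of
boxes for powers of the masses of tops, whose exponents are exactly those that Hölder on the index
set and the two Carleson embeddings require. -/
theorem sparseForm_le_of_two_le {p q : ℝ} (hpq : p.HolderConjugate q) (hp2 : 2 ≤ p)
    (W S : Measure X) [IsFiniteMeasure W] [IsFiniteMeasure S] (m : ι → ℝ≥0∞)
    (hm0 : ∀ i, m i ≠ 0) (hmt : ∀ i, m i ≠ ⊤) {A B : ℝ≥0∞}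
    (hB : ∀ i, W (F.box i) * S (F.box i) ^ (p - 1) ≤ B * m i ^ p)
    (hA : ∀ i, m i ≤ A * (W (F.top i) ^ (1 / p) * S (F.top i) ^ (1 / q)))
    {φ γ : X → ℝ≥0∞} (hφ : Measurable φ) (hγ : Measurable γ) :
    ∑' i, (m i)⁻¹ * ((∫⁻ x in F.box i, φ x ∂S) * ∫⁻ x in F.box i, γ x ∂W) ≤
      B * A ^ (p - 1) * (embeddingConst p * embeddingConst q) *
        ((∫⁻ x, φ x ^ p ∂S) ^ (1 / p) * (∫⁻ x, γ x ^ q ∂W) ^ (1 / q)) := by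
  have hp0 : 0 < p := hpq.pos
  have hq0 : 0 < q := hpq.symm.pos
  have havg : ∀ (μ : Measure X) [IsFiniteMeasure μ] (f : X → ℝ≥0∞) (i : ι),
      ∫⁻ x in F.box i, f x ∂μ ≤ F.avg μ f i * μ (F.box i) := by
    intro μ _ f i
    by_cases h : μ (F.box i) = 0
    · rw [setLIntegral_measure_zero _ _ h]; exact zero_le
    · rw [avg, ENNReal.div_mul_cancel h (measure_ne_top _ _)]
  have hemb : ∀ (μ : Measure X) [IsFiniteMeasure μ] {f : X → ℝ≥0∞} (_ : Measurable f) {r : ℝ}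
      (_ : 1 < r), (∑' i, (F.avg μ f i * μ (F.top i) ^ (1 / r)) ^ r) ^ (1 / r) ≤
        embeddingConst r * (∫⁻ x, f x ^ r ∂μ) ^ (1 / r) := by
    intro μ _ f hf r hr
    have hr0 : 0 < r := by linarith
    rw [embeddingConst, ← ENNReal.mul_rpow_of_nonneg _ _ (by positivity)]
    refine ENNReal.rpow_le_rpow (le_trans (le_of_eq ?_) (F.carleson_embedding hr μ hf)) (by positivity)
    refine tsum_congr fun i => ?_
    rw [ENNReal.mul_rpow_of_nonneg _ _ hr0.le, ← ENNReal.rpow_mul, one_div_mul_cancel hr0.ne',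
      ENNReal.rpow_one]
  calc _ ≤ ∑' i, B * A ^ (p - 1) * ((F.avg S φ i * S (F.top i) ^ (1 / p)) *
        (F.avg W γ i * W (F.top i) ^ (1 / q))) := by
        refine ENNReal.tsum_le_tsum fun i => ?_
        have h := inv_mul_mul_le hpq hp2 (hm0 i) (hmt i) (measure_ne_top S (F.box i))
          (measure_ne_top W (F.box i)) (measure_mono (F.top_subset i))
          (measure_mono (F.top_subset i)) (hB i) (hA i)
        calc _ ≤ (m i)⁻¹ * ((F.avg S φ i * S (F.box i)) * (F.avg W γ i * W (F.box i))) := by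
              gcongr <;> apply havg
          _ = F.avg S φ i * F.avg W γ i * ((m i)⁻¹ * (S (F.box i) * W (F.box i))) := by ring
          _ ≤ F.avg S φ i * F.avg W γ i * (B * A ^ (p - 1) *
                (S (F.top i) ^ (1 / p) * W (F.top i) ^ (1 / q))) := by gcongr
          _ = _ := by ring
    _ ≤ B * A ^ (p - 1) * ((embeddingConst p * (∫⁻ x, φ x ^ p ∂S) ^ (1 / p)) *
        (embeddingConst q * (∫⁻ x, γ x ^ q ∂W) ^ (1 / q))) := by
        rw [ENNReal.tsum_mul_left]
        gcongr
        refine (tsum_mul_le_Lp_mul_Lq hpq _ _).trans ?_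
        exact mul_le_mul' (hemb S hφ hpq.lt) (hemb W hγ hpq.symm.lt)
    _ = _ := by ring

/-- The sharp two-weight bound for the positive sparse form of a nested family. -/
theorem sparseForm_le {p q : ℝ} (hpq : p.HolderConjugate q)
    (W S : Measure X) [IsFiniteMeasure W] [IsFiniteMeasure S] (m : ι → ℝ≥0∞)
    (hm0 : ∀ i, m i ≠ 0) (hmt : ∀ i, m i ≠ ⊤) {A B : ℝ≥0∞} (hA1 : 1 ≤ A)
    (hB : ∀ i, W (F.box i) * S (F.box i) ^ (p - 1) ≤ B * m i ^ p)
    (hA : ∀ i, m i ≤ A * (W (F.top i) ^ (1 / p) * S (F.top i) ^ (1 / q)))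
    {φ γ : X → ℝ≥0∞} (hφ : Measurable φ) (hγ : Measurable γ) :
    ∑' i, (m i)⁻¹ * ((∫⁻ x in F.box i, φ x ∂S) * ∫⁻ x in F.box i, γ x ∂W) ≤
      B ^ max 1 (1 / (p - 1)) * A ^ (p + q) * (embeddingConst p * embeddingConst q) *
        ((∫⁻ x, φ x ^ p ∂S) ^ (1 / p) * (∫⁻ x, γ x ^ q ∂W) ^ (1 / q)) := by
  have hp1 : 0 < p - 1 := hpq.sub_one_pos
  have hp0 := hpq.pos
  have hq0 := hpq.symm.pos
  have hqp : q - 1 = 1 / (p - 1) := by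
    rw [hpq.conjugate_eq]; field_simp; ring
  rcases le_total 2 p with h2 | h2
  · refine (F.sparseForm_le_of_two_le hpq h2 W S m hm0 hmt hB hA hφ hγ).trans ?_
    rw [max_eq_left (by rw [div_le_one hp1]; linarith), ENNReal.rpow_one]
    gcongr
    linarith
  -- The form is symmetric under exchange of `(p, W)` and `(q, S)`. Raising `hB` to the power `q - 1
  -- = 1/(p-1)` gives the dual hypothesis, with constant `B ^ (1/(p-1))`.
  · have hq2 : 2 ≤ q := by
      have : 1 ≤ 1 / (p - 1) := by rw [le_div_iff₀ hp1]; linarith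
      linarith
    have hB' : ∀ i, S (F.box i) * W (F.box i) ^ (q - 1) ≤ B ^ (1 / (p - 1)) * m i ^ q := by
      intro i
      have h := ENNReal.rpow_le_rpow (hB i) (show 0 ≤ q - 1 by linarith)
      have x1 : (p - 1) * (q - 1) = 1 := by rw [hqp]; field_simp
      have x2 : p * (q - 1) = q := by rw [hqp, hpq.conjugate_eq]; ring
      rw [ENNReal.mul_rpow_of_nonneg _ _ (by linarith), ENNReal.mul_rpow_of_nonneg _ _ (by linarith),
        ← ENNReal.rpow_mul, ← ENNReal.rpow_mul, x1, x2, ENNReal.rpow_one, mul_comm] at h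
      rwa [← hqp]
    have hA' : ∀ i, m i ≤ A * (S (F.top i) ^ (1 / q) * W (F.top i) ^ (1 / p)) := fun i => by
      rw [mul_comm (S _ ^ _)]; exact hA i
    have h := F.sparseForm_le_of_two_le hpq.symm hq2 S W m hm0 hmt hB' hA' hγ hφ
    have hx : max 1 (1 / (p - 1)) = 1 / (p - 1) :=
      max_eq_right (by rw [le_div_iff₀ hp1]; linarith)
    rw [hx]
    calc _ = ∑' i, (m i)⁻¹ * ((∫⁻ x in F.box i, γ x ∂W) * ∫⁻ x in F.box i, φ x ∂S) := by
          refine tsum_congr fun i => ?_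
          ring
      _ ≤ _ := h
      _ = B ^ (1 / (p - 1)) * A ^ (q - 1) * (embeddingConst p * embeddingConst q) *
        ((∫⁻ x, φ x ^ p ∂S) ^ (1 / p) * (∫⁻ x, γ x ^ q ∂W) ^ (1 / q)) := by ring
      _ ≤ _ := by
        gcongr
        linarith

end NestedFamily


/-! ### Dyadic Carleson boxes -/

/-- The chord has length `2 |sin (π t)|`, where `t` is the offset of `u` from the nearest integer,
and Jordan's inequality bounds it below by `4 |t|`. -/
theorem exists_int_four_mul_abs_sub_le (u : ℝ) :
    ∃ m : ℤ, 4 * |u - m| ≤ ‖Complex.exp (Complex.I * (2 * Real.pi * u : ℝ)) - 1‖ := by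
  refine ⟨round u, ?_⟩
  set t := u - round u with ht
  have h1 : |t| ≤ 1 / 2 := abs_sub_round u
  have h2 : Complex.exp (Complex.I * (2 * Real.pi * u : ℝ)) =
      Complex.exp (Complex.I * (2 * Real.pi * t : ℝ)) := by
    rw [Complex.exp_eq_exp_iff_exists_int]
    refine ⟨round u, ?_⟩
    rw [ht]; push_cast; ring
  rw [h2, Complex.norm_exp_I_mul_ofReal_sub_one, norm_mul, Real.norm_eq_abs, Real.norm_eq_abs,
    abs_of_pos (two_pos : (0 : ℝ) < 2)]
  have hpi := Real.pi_pos
  have h3 : |Real.pi * t| ≤ Real.pi / 2 := by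
    rw [abs_mul, abs_of_pos hpi]; nlinarith
  have h4 := Real.mul_abs_le_abs_sin h3
  rw [show 2 * Real.pi * t / 2 = Real.pi * t by ring]
  have h5 : 2 / Real.pi * |Real.pi * t| = 2 * |t| := by
    rw [abs_mul, abs_of_pos hpi]; field_simp
  linarith

/-- The argument of `z` as a fraction of the full turn. -/
def turn (z : ℂ) : ℝ := Complex.arg z / (2 * Real.pi)

theorem eq_norm_mul_exp_turn (z : ℂ) :
    z = ‖z‖ * Complex.exp (Complex.I * (2 * Real.pi * turn z : ℝ)) := by
  have : 2 * Real.pi * turn z = Complex.arg z := by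
    rw [turn]; field_simp
  rw [this, mul_comm Complex.I, Complex.norm_mul_exp_arg_mul_I]

theorem measurable_turn : Measurable turn := Complex.measurable_arg.div_const _

/-- The index of the dyadic arc of generation `k`, in the grid shifted by `τ`, above which `z`
lies. -/
def cell (τ : ℝ) (k : ℕ) (z : ℂ) : ℤ := ⌊2 ^ k * Int.fract (turn z - τ)⌋

theorem measurable_cell (τ : ℝ) (k : ℕ) : Measurable (cell τ k) := by
  have := measurable_turn
  unfold cell
  exact Int.measurable_floor.comp (measurable_const.mul (measurable_fract.comp (this.sub_const τ)))

/-- The coarse index is the integer quotient of the fine one by `2 ^ (l - k)`; hence dyadic arcs are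
nested. -/
theorem floor_two_pow_mul_eq {a b : ℝ} {k l : ℕ} (hkl : k ≤ l) (h : ⌊2 ^ l * a⌋ = ⌊2 ^ l * b⌋) :
    ⌊2 ^ k * a⌋ = ⌊2 ^ k * b⌋ := by
  have key : ∀ x : ℝ, ⌊2 ^ k * x⌋ = ⌊2 ^ l * x⌋ / (2 ^ (l - k) : ℕ) := by
    intro x
    rw [← Int.floor_div_natCast]
    congr 1
    obtain ⟨d, rfl⟩ := Nat.exists_eq_add_of_le hkl
    rw [Nat.add_sub_cancel_left, pow_add]
    push_cast
    field_simp
  rw [key, key, h]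

/-- The dyadic Carleson boxes of the grid shifted by `τ`, with their top halves. -/
def dyadicFamily (τ : ℝ) : NestedFamily ℂ (Σ k : ℕ, Fin (2 ^ k)) where
  box i := {z | ‖z‖ < 1 ∧ 1 - ‖z‖ ≤ (2 ^ i.1)⁻¹ ∧ cell τ i.1 z = (i.2 : ℕ)}
  top i := {z | (2 ^ (i.1 + 1))⁻¹ < 1 - ‖z‖ ∧ 1 - ‖z‖ ≤ (2 ^ i.1)⁻¹ ∧ cell τ i.1 z = (i.2 : ℕ)}
  gen i := i.1
  measurableSet_box i := by
    refine (measurableSet_lt measurable_norm measurable_const).inter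
      ((measurableSet_le (measurable_const.sub measurable_norm) measurable_const).inter
        (measurable_cell τ i.1 (measurableSet_singleton _)))
  measurableSet_top i := by
    refine (measurableSet_lt measurable_const (measurable_const.sub measurable_norm)).inter
      ((measurableSet_le (measurable_const.sub measurable_norm) measurable_const).inter
        (measurable_cell τ i.1 (measurableSet_singleton _)))
  top_subset i z hz := ⟨by
    have : (0 : ℝ) < (2 ^ (i.1 + 1))⁻¹ := by positivity
    linarith [hz.1], hz.2⟩
  disjoint_top := by
    have aux : ∀ {k l : ℕ} {x : ℝ}, (2 ^ (k + 1))⁻¹ < x → x ≤ (2 ^ l)⁻¹ → l ≤ k := by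
      intro k l x h1 h2
      by_contra hlt
      have h3 : ((2 : ℝ) ^ l)⁻¹ ≤ (2 ^ (k + 1))⁻¹ :=
        inv_anti₀ (by positivity) (pow_le_pow_right₀ one_le_two (by omega))
      linarith
    rintro ⟨k, m⟩ ⟨l, n⟩ hij
    refine Set.disjoint_left.2 fun z hz hz' => hij ?_
    obtain rfl : k = l := le_antisymm (aux hz'.1 hz.2.1) (aux hz.1 hz'.2.1)
    have : m = n := by
      have h := hz.2.2.symm.trans hz'.2.2
      exact Fin.ext (by exact_mod_cast h)
    rw [this]
  nested := by
    rintro ⟨k, m⟩ ⟨l, n⟩ hkl ⟨z, hz, hz'⟩ w hw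
    have hkl : k ≤ l := hkl
    have h3 : ((2 : ℝ) ^ l)⁻¹ ≤ (2 ^ k)⁻¹ :=
      inv_anti₀ (by positivity) (pow_le_pow_right₀ one_le_two hkl)
    exact ⟨hw.1, hw.2.1.trans h3,
      (floor_two_pow_mul_eq hkl (hw.2.2.trans hz'.2.2.symm)).trans hz.2.2⟩
  eq_of_gen_eq := by
    rintro ⟨k, m⟩ ⟨l, n⟩ hkl ⟨z, hz, hz'⟩
    obtain rfl : k = l := hkl
    have : m = n := by
      have h := hz.2.2.symm.trans hz'.2.2
      exact Fin.ext (by exact_mod_cast h)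
    rw [this]

theorem cell_nonneg (τ : ℝ) (k : ℕ) (z : ℂ) : 0 ≤ cell τ k z :=
  Int.floor_nonneg.2 (mul_nonneg (by positivity) (Int.fract_nonneg _))

theorem cell_lt (τ : ℝ) (k : ℕ) (z : ℂ) : cell τ k z < (2 ^ k : ℕ) := by
  rw [cell, Int.floor_lt]
  push_cast
  have h1 := Int.fract_lt_one (turn z - τ)
  have h2 : (0 : ℝ) < 2 ^ k := by positivity
  nlinarith

/-- The centre of the dyadic arc with index `i`. -/
def arcCentre (τ : ℝ) (i : Σ k : ℕ, Fin (2 ^ k)) : ℝ :=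
  2 * Real.pi * (τ + ((i.2 : ℕ) + 1 / 2) / 2 ^ i.1)

theorem dyadicBox_subset (τ : ℝ) (i : Σ k : ℕ, Fin (2 ^ k)) :
    (dyadicFamily τ).box i ⊆ carlesonBox (arcCentre τ i) (2 ^ i.1)⁻¹ := by
  rintro z ⟨h1, h2, h3⟩
  have hpi := Real.pi_pos
  have h2k : (0 : ℝ) < 2 ^ i.1 := by positivity
  -- The angle is measured from the origin of the shifted grid; the principal argument may differ
  -- from the centre of the arc by a full turn.
  refine ⟨h1, ‖z‖, 2 * Real.pi * (τ + Int.fract (turn z - τ)), norm_nonneg _, ?_, h2, ?_⟩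
  · conv_lhs => rw [eq_norm_mul_exp_turn z]
    congr 1
    rw [Complex.exp_eq_exp_iff_exists_int]
    refine ⟨⌊turn z - τ⌋, ?_⟩
    have : turn z = τ + Int.fract (turn z - τ) + ⌊turn z - τ⌋ := by
      linarith [Int.floor_add_fract (turn z - τ)]
    conv_lhs => rw [this]
    push_cast; ring
  · rw [cell, Int.floor_eq_iff] at h3
    obtain ⟨h4, h5⟩ := h3
    push_cast at h4 h5
    rw [arcCentre, ← mul_sub, abs_mul, abs_of_pos (by positivity : (0 : ℝ) < 2 * Real.pi)]
    have h6 : |τ + Int.fract (turn z - τ) - (τ + ((i.2 : ℕ) + 1 / 2) / 2 ^ i.1)| ≤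
        (2 ^ i.1)⁻¹ / 2 := by
      have e : τ + Int.fract (turn z - τ) - (τ + ((i.2 : ℕ) + 1 / 2) / 2 ^ i.1) =
          (2 ^ i.1)⁻¹ * (2 ^ i.1 * Int.fract (turn z - τ) - (i.2 : ℕ) - 1 / 2) := by
        field_simp; ring
      rw [e, abs_mul, abs_of_pos (by positivity : (0 : ℝ) < (2 ^ i.1)⁻¹)]
      have h7 : |2 ^ i.1 * Int.fract (turn z - τ) - (i.2 : ℕ) - 1 / 2| ≤ 1 / 2 := by
        rw [abs_le]; constructor <;> linarith
      nlinarith [inv_pos.2 h2k]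
    nlinarith

/-- The box lies in a disk about the boundary point `exp (i θ₀)`: the radial displacement is at most
`s` and the angular one at most `π s`. -/
theorem volume_carlesonBox_le (θ₀ : ℝ) {s : ℝ} :
    volume (carlesonBox θ₀ s) ≤ ENNReal.ofReal (Real.pi * (1 + Real.pi) ^ 2) * ENNReal.ofReal s ^ 2 := by
  have hpi := Real.pi_pos
  have hsub : carlesonBox θ₀ s ⊆ closedBall (Complex.exp (θ₀ * Complex.I)) ((1 + Real.pi) * s) := by
    rintro z ⟨h1, r, θ, hr, rfl, h2, h3⟩
    have hn : ‖(r : ℂ) * Complex.exp (θ * Complex.I)‖ = r := by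
      rw [norm_mul, Complex.norm_exp_ofReal_mul_I, Complex.norm_real, Real.norm_of_nonneg hr, mul_one]
    rw [hn] at h1
    rw [mem_closedBall, dist_eq_norm]
    have e : (r : ℂ) * Complex.exp (θ * Complex.I) - Complex.exp (θ₀ * Complex.I) =
        ((r - 1 : ℝ) : ℂ) * Complex.exp (θ * Complex.I) +
          Complex.exp (θ₀ * Complex.I) * (Complex.exp (Complex.I * (θ - θ₀ : ℝ)) - 1) := by
      rw [mul_sub, ← Complex.exp_add,
        show θ₀ * Complex.I + Complex.I * (θ - θ₀ : ℝ) = θ * Complex.I by push_cast; ring]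
      push_cast; ring
    rw [e]
    refine (norm_add_le _ _).trans ?_
    rw [norm_mul, norm_mul, Complex.norm_exp_ofReal_mul_I, Complex.norm_exp_ofReal_mul_I,
      Complex.norm_real, Real.norm_eq_abs, abs_of_neg (by linarith), mul_one, one_mul]
    have := Real.norm_exp_I_mul_ofReal_sub_one_le (x := θ - θ₀)
    rw [Real.norm_eq_abs] at this
    nlinarith
  refine (measure_mono hsub).trans ?_
  rw [Complex.volume_closedBall, ENNReal.ofReal_mul (by positivity), mul_pow,
    ENNReal.ofReal_mul hpi.le, ← ENNReal.ofReal_pow (by positivity : 0 ≤ 1 + Real.pi),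
    ← NNReal.coe_real_pi, ENNReal.ofReal_coe_nnreal]
  apply le_of_eq; ring

/-- An inscribed disk, centred at the middle height `3/4 · 2⁻ᵏ` of the shell, bounds the area of the
top from below without integrating over it. -/
theorem ball_subset_dyadicTop (τ : ℝ) (i : Σ k : ℕ, Fin (2 ^ k)) :
    ball (((1 - 3 / 4 * (2 ^ i.1)⁻¹ : ℝ) : ℂ) * Complex.exp (Complex.I * arcCentre τ i))
      ((2 ^ i.1)⁻¹ / 16) ⊆ (dyadicFamily τ).top i := by
  intro z hz
  obtain ⟨k, n⟩ := i
  simp only [] at hz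
  set s : ℝ := (2 ^ k)⁻¹ with hs
  have hs0 : 0 < s := by positivity
  have hs1 : s ≤ 1 := inv_le_one_of_one_le₀ (one_le_pow₀ one_le_two)
  set θ := arcCentre τ ⟨k, n⟩ with hθ
  set r : ℝ := 1 - 3 / 4 * s with hr
  have hr0 : 0 < r := by linarith
  rw [mem_ball, dist_eq_norm] at hz
  have hexp : ∀ t : ℝ, ‖Complex.exp (Complex.I * t)‖ = 1 := fun t => by
    rw [mul_comm, Complex.norm_exp_ofReal_mul_I]
  have hcn : ‖(r : ℂ) * Complex.exp (Complex.I * θ)‖ = r := by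
    rw [norm_mul, hexp, Complex.norm_real, Real.norm_of_nonneg hr0.le, mul_one]
  have h1 : |‖z‖ - r| < s / 16 := by
    have := abs_norm_sub_norm_le z ((r : ℂ) * Complex.exp (Complex.I * θ))
    rw [hcn] at this
    linarith
  rw [abs_lt] at h1
  -- Since `‖z‖ ≥ 1 - 3/4 - 1/16`, the chord bound gives an angular offset of at most `s/6`, less
  -- than the half-length `s/2` of the arc.
  have hzlow : 3 / 16 * 1 ≤ ‖z‖ := by linarith
  set u := turn z - θ / (2 * Real.pi) with hu
  have hpi := Real.pi_pos
  have h2 : ‖z‖ * ‖Complex.exp (Complex.I * (2 * Real.pi * u : ℝ)) - 1‖ ≤ s / 8 := by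
    have e : z - (‖z‖ : ℂ) * Complex.exp (Complex.I * θ) =
        (‖z‖ : ℂ) * (Complex.exp (Complex.I * θ) *
          (Complex.exp (Complex.I * (2 * Real.pi * u : ℝ)) - 1)) := by
      conv_lhs => rw [show z - (‖z‖ : ℂ) * Complex.exp (Complex.I * θ) =
        ‖z‖ * Complex.exp (Complex.I * (2 * Real.pi * turn z : ℝ)) -
          (‖z‖ : ℂ) * Complex.exp (Complex.I * θ) by rw [← eq_norm_mul_exp_turn z]]
      have : Complex.I * (2 * Real.pi * turn z : ℝ) =
          Complex.I * θ + Complex.I * (2 * Real.pi * u : ℝ) := by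
        rw [← mul_add, ← Complex.ofReal_add]
        congr 2
        rw [hu]; field_simp; ring
      rw [this, Complex.exp_add]; ring
    have e2 := congrArg norm e
    rw [norm_mul, norm_mul, hexp, one_mul, Complex.norm_real, Real.norm_of_nonneg (norm_nonneg z)]
      at e2
    rw [← e2]
    have e3 : z - (‖z‖ : ℂ) * Complex.exp (Complex.I * θ) =
        (z - r * Complex.exp (Complex.I * θ)) + ((r - ‖z‖ : ℝ) : ℂ) * Complex.exp (Complex.I * θ) := by
      push_cast; ring
    rw [e3]
    refine (norm_add_le _ _).trans ?_
    rw [norm_mul, hexp, Complex.norm_real, Real.norm_eq_abs, mul_one]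
    have : |r - ‖z‖| ≤ s / 16 := by rw [abs_le]; constructor <;> linarith
    linarith
  obtain ⟨m, hm⟩ := exists_int_four_mul_abs_sub_le u
  have h3 : |u - m| < s / 2 := by
    nlinarith [abs_nonneg (u - m), norm_nonneg (Complex.exp (Complex.I * (2 * Real.pi * u : ℝ)) - 1)]
  rw [abs_lt] at h3
  have hθ' : θ / (2 * Real.pi) = τ + (n + 1 / 2) * s := by
    rw [hθ, arcCentre, hs]; field_simp
  have hks : 2 ^ k * s = 1 := by rw [hs]; field_simp
  have hn : (n : ℕ) + (1 : ℝ) ≤ 2 ^ k := by exact_mod_cast n.2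
  have hfr : Int.fract (turn z - τ) = turn z - τ - m := by
    rw [Int.fract_eq_iff]
    refine ⟨?_, ?_, m, by ring⟩
    · have : (0 : ℝ) ≤ (n : ℕ) * s := by positivity
      linarith
    · have : ((n : ℕ) + (1 : ℝ)) * s ≤ 1 := (mul_le_mul_of_nonneg_right hn hs0.le).trans hks.le
      linarith
  refine ⟨?_, ?_, ?_⟩
  · simp only [pow_succ, mul_inv]
    rw [← hs]; linarith
  · change 1 - ‖z‖ ≤ s
    linarith
  · change ⌊2 ^ k * Int.fract (turn z - τ)⌋ = _
    rw [hfr, Int.floor_eq_iff]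
    have h2k : (0 : ℝ) < 2 ^ k := by positivity
    have e : 2 ^ k * (turn z - τ - m) = n + 1 / 2 + 2 ^ k * (u - m) := by
      rw [hu, hθ']
      have : ∀ a : ℝ, 2 ^ k * (a * s) = a := fun a => by rw [mul_left_comm, hks, mul_one]
      linear_combination this (n + 1 / 2)
    rw [e]
    push_cast
    constructor <;> nlinarith

/-- The factor `256 = 16²` comes from the inscribed disk of radius `2⁻ᵏ / 16`; the factor `π ≥ 1` is
discarded. -/
theorem le_volume_dyadicTop (τ : ℝ) (i : Σ k : ℕ, Fin (2 ^ k)) :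
    ENNReal.ofReal (2 ^ i.1)⁻¹ ^ 2 ≤ 256 * volume ((dyadicFamily τ).top i) := by
  refine le_trans ?_ (mul_le_mul_right (measure_mono (ball_subset_dyadicTop τ i)) _)
  rw [Complex.volume_ball, ENNReal.ofReal_div_of_pos (by norm_num), div_eq_mul_inv, mul_pow]
  have h1 : (1 : ℝ≥0∞) ≤ NNReal.pi := by
    have : (1 : NNReal) ≤ NNReal.pi := by
      rw [← NNReal.coe_le_coe, NNReal.coe_real_pi, NNReal.coe_one]; linarith [Real.pi_gt_three]
    exact_mod_cast this
  have h2 : (256 : ℝ≥0∞) * (ENNReal.ofReal 16)⁻¹ ^ 2 = 1 := by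
    rw [ENNReal.ofReal_ofNat, ← ENNReal.inv_pow, show (16 : ℝ≥0∞) ^ 2 = 256 by norm_num]
    exact ENNReal.mul_inv_cancel (by norm_num) (by norm_num)
  calc ENNReal.ofReal (2 ^ i.1)⁻¹ ^ 2 = 256 * (ENNReal.ofReal 16)⁻¹ ^ 2 * ENNReal.ofReal (2 ^ i.1)⁻¹ ^ 2 * 1 := by
        rw [h2]; simp
    _ ≤ 256 * (ENNReal.ofReal 16)⁻¹ ^ 2 * ENNReal.ofReal (2 ^ i.1)⁻¹ ^ 2 * NNReal.pi := by gcongr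
    _ = _ := by ring

/-! ### Domination of the Bergman kernel by two dyadic grids. -/

/-- Two nearby points of the circle lie in the same arc of one of two adjacent dyadic grids. -/
theorem exists_shift_floor_eq {x y : ℝ} {k : ℕ} (h : 2 ^ k * |x - y| < 1 / 3) :
    ⌊2 ^ k * (x - 0)⌋ = ⌊2 ^ k * (y - 0)⌋ ∨ ⌊2 ^ k * (x - 1 / 3)⌋ = ⌊2 ^ k * (y - 1 / 3)⌋ := by
  wlog hxy : x ≤ y generalizing x y
  · rw [abs_sub_comm] at h
    rcases this h (le_of_not_ge hxy) with h | h
    · exact Or.inl h.symm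
    · exact Or.inr h.symm
  by_contra! hcon
  obtain ⟨h1, h2⟩ := hcon
  have h2k : (0 : ℝ) < 2 ^ k := by positivity
  rw [abs_of_nonpos (by linarith)] at h
  have aux : ∀ {a b : ℝ}, a ≤ b → ⌊a⌋ ≠ ⌊b⌋ → ∃ c : ℤ, a < c ∧ c ≤ b := by
    intro a b hab hne
    have := lt_of_le_of_ne (Int.floor_mono hab) hne
    exact ⟨⌊b⌋, Int.floor_lt.1 this, Int.floor_le b⟩
  obtain ⟨c, hc1, hc2⟩ := aux (by gcongr) h1
  obtain ⟨d, hd1, hd2⟩ := aux (by gcongr) h2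
  -- If both grids separate `x` from `y`, the points `c / 2ᵏ` and `1/3 + d / 2ᵏ` are less than `2⁻ᵏ
  -- / 3` apart. Then `3 (c - d) - 2ᵏ` is an integer of absolute value below `1`, so `3` divides a
  -- power of `2`.
  have h3 : 3 * ((c : ℝ) - d) - 2 ^ k < 1 := by linarith
  have h4 : -1 < 3 * ((c : ℝ) - d) - 2 ^ k := by linarith
  have h3' : 3 * (c - d) - 2 ^ k < 1 := by exact_mod_cast h3
  have h4' : -1 < 3 * (c - d) - 2 ^ k := by exact_mod_cast h4
  have h5 : (2 : ℤ) ^ k = 3 * (c - d) := by omega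
  have h6 : (3 : ℤ) ∣ 2 ^ k := ⟨_, h5⟩
  have h7 := Int.prime_three.dvd_of_dvd_pow h6
  norm_num at h7

/-- Passage from the line to the circle: equality at scale `k` implies equality of integer parts, so
it survives reduction modulo `1`. -/
theorem floor_mul_fract_eq {a b : ℝ} {k : ℕ} {m : ℤ} (h : ⌊2 ^ k * a⌋ = ⌊2 ^ k * (b + m)⌋) :
    ⌊2 ^ k * Int.fract a⌋ = ⌊2 ^ k * Int.fract b⌋ := by
  have h0 : ⌊a⌋ = ⌊b + m⌋ := by
    have := floor_two_pow_mul_eq (Nat.zero_le k) h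
    simpa using this
  have key : ∀ x : ℝ, ⌊2 ^ k * Int.fract x⌋ = ⌊2 ^ k * x⌋ - 2 ^ k * ⌊x⌋ := by
    intro x
    rw [Int.fract, mul_sub, show (2 : ℝ) ^ k * ⌊x⌋ = ((2 ^ k * ⌊x⌋ : ℤ) : ℝ) by push_cast; rfl,
      Int.floor_sub_intCast]
  rw [← Int.fract_add_intCast b m, key, key, h, h0]

/-- The point `r e^{iφ}` is at distance `1 - r` from the circle, and `1 - r` is itself at most the
norm on the right. -/
theorem norm_exp_sub_one_le (r φ : ℝ) (hr0 : 0 ≤ r) (hr : r ≤ 1) :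
    ‖Complex.exp (Complex.I * φ) - 1‖ ≤ 2 * ‖1 - r * Complex.exp (Complex.I * φ)‖ := by
  have hexp : ‖Complex.exp (Complex.I * φ)‖ = 1 := by
    rw [mul_comm, Complex.norm_exp_ofReal_mul_I]
  have h1 : 1 - r ≤ ‖1 - r * Complex.exp (Complex.I * φ)‖ := by
    have := norm_sub_norm_le (1 : ℂ) (r * Complex.exp (Complex.I * φ))
    rw [norm_mul, hexp, Complex.norm_real, Real.norm_of_nonneg hr0] at this
    simpa using this
  have e : Complex.exp (Complex.I * φ) - 1 = ((1 - r : ℝ) : ℂ) * Complex.exp (Complex.I * φ) -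
      (1 - r * Complex.exp (Complex.I * φ)) := by push_cast; ring
  rw [e]
  refine (norm_sub_le _ _).trans ?_
  rw [norm_mul, hexp, Complex.norm_real, Real.norm_of_nonneg (by linarith)]
  linarith

theorem mem_dyadicBox_of_cell_eq {τ : ℝ} {k : ℕ} {z w : ℂ} (hz : ‖z‖ < 1) (hw : ‖w‖ < 1)
    (hz' : 1 - ‖z‖ ≤ (2 ^ k)⁻¹) (hw' : 1 - ‖w‖ ≤ (2 ^ k)⁻¹) (h : cell τ k z = cell τ k w) :
    ∃ n : Fin (2 ^ k), z ∈ (dyadicFamily τ).box ⟨k, n⟩ ∧ w ∈ (dyadicFamily τ).box ⟨k, n⟩ := by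
  have h0 := cell_nonneg τ k z
  have h1 := cell_lt τ k z
  refine ⟨⟨(cell τ k z).toNat, by omega⟩, ⟨hz, hz', ?_⟩, hw, hw', ?_⟩
  · simp [h0]
  · simp only []; rw [← h]; simp [h0]

/-- The quantity `D = |1 - z w̄|` dominates both heights `1 - |z|`, `1 - |w|`, and the angular
distance is at most `D/2` of a turn. At the scale `2D ≤ 2⁻ᵏ < 4D` the points lie low enough, and
their angles differ by at most `2⁻ᵏ / 4 < 2⁻ᵏ / 3`, so one of the two grids does not separate them.
-/
theorem exists_dyadicBox {z w : ℂ} (hz : ‖z‖ < 1) (hw : ‖w‖ < 1) :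
    ∃ i, (2 ^ i.1)⁻¹ ≤ 4 * ‖1 - z * (starRingEnd ℂ) w‖ ∧
      ((z ∈ (dyadicFamily 0).box i ∧ w ∈ (dyadicFamily 0).box i) ∨
        (z ∈ (dyadicFamily (1 / 3)).box i ∧ w ∈ (dyadicFamily (1 / 3)).box i)) := by
  set D := ‖1 - z * (starRingEnd ℂ) w‖ with hD
  have hzw : ‖z * (starRingEnd ℂ) w‖ = ‖z‖ * ‖w‖ := by rw [norm_mul, RCLike.norm_conj]
  have hD1 : 1 - ‖z‖ * ‖w‖ ≤ D := by
    have := norm_sub_norm_le (1 : ℂ) (z * (starRingEnd ℂ) w)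
    rw [hzw] at this
    simpa using this
  have hDz : 1 - ‖z‖ ≤ D := by nlinarith [norm_nonneg z, norm_nonneg w]
  have hDw : 1 - ‖w‖ ≤ D := by nlinarith [norm_nonneg z, norm_nonneg w]
  have hD0 : 0 < D := by linarith
  by_cases hbig : 1 / 2 < D
  -- At this distance the box of generation `0`, which is the whole disk, is small enough.
  · have hc : cell 0 0 z = cell 0 0 w := by
      have := cell_nonneg 0 0 z; have := cell_lt 0 0 z
      have := cell_nonneg 0 0 w; have := cell_lt 0 0 w
      simp only [pow_zero] at *
      omega
    obtain ⟨n, hn⟩ := mem_dyadicBox_of_cell_eq hz hw (by simp) (by simp) hc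
    refine ⟨⟨0, n⟩, ?_, Or.inl hn⟩
    simp only [pow_zero, inv_one]; linarith
  push Not at hbig
  obtain ⟨k, hk1, hk2⟩ := exists_nat_pow_near (x := (2 * D)⁻¹) (y := 2)
    ((one_le_inv₀ (by positivity)).2 (by linarith)) one_lt_two
  have h2k : (0 : ℝ) < 2 ^ k := by positivity
  have hk3 : 2 ^ k * (2 * D) ≤ 1 := by
    rwa [← one_div, le_div_iff₀ (by positivity)] at hk1
  have hk4 : 2 * D ≤ (2 ^ k)⁻¹ := by
    rw [← one_div, le_div_iff₀ h2k]; linarith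
  have hk5 : (2 ^ k)⁻¹ ≤ 4 * D := by
    rw [← one_div, div_lt_iff₀ (by positivity), pow_succ] at hk2
    rw [← one_div, div_le_iff₀ h2k]; nlinarith
  obtain ⟨m, hm⟩ := exists_int_four_mul_abs_sub_le (turn z - turn w)
  have e : z * (starRingEnd ℂ) w = ((‖z‖ * ‖w‖ : ℝ) : ℂ) *
      Complex.exp (Complex.I * (2 * Real.pi * (turn z - turn w) : ℝ)) := by
    conv_lhs => rw [eq_norm_mul_exp_turn z, eq_norm_mul_exp_turn w]
    rw [map_mul, ← Complex.exp_conj, map_mul, Complex.conj_I, Complex.conj_ofReal,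
      Complex.conj_ofReal, mul_mul_mul_comm, ← Complex.exp_add]
    push_cast
    congr 2; ring
  have hle := norm_exp_sub_one_le (‖z‖ * ‖w‖) (2 * Real.pi * (turn z - turn w)) (by positivity)
    (by nlinarith [norm_nonneg z, norm_nonneg w])
  rw [← e, ← hD] at hle
  have hdist : 2 ^ k * |turn z - (turn w + m)| < 1 / 3 := by
    have : |turn z - (turn w + m)| ≤ D / 2 := by
      rw [← sub_sub]; linarith
    nlinarith
  have hz' : 1 - ‖z‖ ≤ (2 ^ k)⁻¹ := by linarith
  have hw' : 1 - ‖w‖ ≤ (2 ^ k)⁻¹ := by linarith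
  rcases exists_shift_floor_eq hdist with h | h
  · have hc : cell 0 k z = cell 0 k w :=
      floor_mul_fract_eq (m := m) (by rw [h]; congr 2; ring)
    obtain ⟨n, hn⟩ := mem_dyadicBox_of_cell_eq hz hw hz' hw' hc
    exact ⟨⟨k, n⟩, hk5, Or.inl hn⟩
  · have hc : cell (1 / 3) k z = cell (1 / 3) k w :=
      floor_mul_fract_eq (m := m) (by rw [h]; congr 2; ring)
    obtain ⟨n, hn⟩ := mem_dyadicBox_of_cell_eq hz hw hz' hw' hc
    exact ⟨⟨k, n⟩, hk5, Or.inr hn⟩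

/-- The modulus of the Bergman kernel of the disk, up to the factor `1 / π`. -/
def absKernel (z w : ℂ) : ℝ≥0∞ := ENNReal.ofReal (‖1 - z * (starRingEnd ℂ) w‖ ^ 2)⁻¹

/-- A single term of one of the sums is enough; `16` is the square of the constant `4` of
`exists_dyadicBox`. -/
theorem absKernel_le {z w : ℂ} (hz : ‖z‖ < 1) (hw : ‖w‖ < 1) :
    absKernel z w ≤ 16 *
      (∑' i, (ENNReal.ofReal (2 ^ i.1)⁻¹ ^ 2)⁻¹ * (((dyadicFamily 0).box i).indicator 1 z *
          ((dyadicFamily 0).box i).indicator 1 w) +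
        ∑' i, (ENNReal.ofReal (2 ^ i.1)⁻¹ ^ 2)⁻¹ * (((dyadicFamily (1 / 3)).box i).indicator 1 z *
          ((dyadicFamily (1 / 3)).box i).indicator 1 w)) := by
  obtain ⟨i, hi, h⟩ := exists_dyadicBox hz hw
  have h2k : (0 : ℝ) < (2 ^ i.1)⁻¹ := by positivity
  have h1 : absKernel z w ≤ 16 * (ENNReal.ofReal (2 ^ i.1)⁻¹ ^ 2)⁻¹ := by
    rw [absKernel, ← ENNReal.ofReal_pow h2k.le, ← ENNReal.ofReal_inv_of_pos (by positivity),
      ← ENNReal.ofReal_ofNat, ← ENNReal.ofReal_mul (by norm_num)]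
    refine ENNReal.ofReal_le_ofReal ?_
    rw [← div_eq_mul_inv, ← one_div, div_le_div_iff₀ (by nlinarith [norm_nonneg (1 - z * (starRingEnd ℂ) w)]) (by positivity)]
    nlinarith
  refine h1.trans (mul_le_mul_right ?_ _)
  rcases h with ⟨h, h'⟩ | ⟨h, h'⟩
  · refine le_trans ?_ le_self_add
    refine le_trans (le_of_eq ?_) (ENNReal.le_tsum i)
    rw [indicator_of_mem h, indicator_of_mem h']; simp
  · refine le_trans ?_ le_add_self
    refine le_trans (le_of_eq ?_) (ENNReal.le_tsum i)
    rw [indicator_of_mem h, indicator_of_mem h']; simp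


/-! ### The weighted estimate on the disk -/

/-- The extremal test function is `G ^ (p - 1)`. Truncating `G` at `N` makes the norm finite, so
that it can be cancelled; monotone convergence removes the truncation. -/
theorem rpow_lintegral_le_of_forall_dual {X : Type*} [MeasurableSpace X] {p q : ℝ}
    (hpq : p.HolderConjugate q) (W : Measure X) [IsFiniteMeasure W] {G : X → ℝ≥0∞}
    (hG : Measurable G) {K : ℝ≥0∞}
    (h : ∀ γ : X → ℝ≥0∞, Measurable γ → ∫⁻ x, G x * γ x ∂W ≤ K * (∫⁻ x, γ x ^ q ∂W) ^ (1 / q)) :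
    (∫⁻ x, G x ^ p ∂W) ^ (1 / p) ≤ K := by
  have hp0 : 0 < p := hpq.pos
  have hq0 : 0 < q := hpq.symm.pos
  have hp1 : 0 < p - 1 := hpq.sub_one_pos
  have key : ∀ N : ℕ, (∫⁻ x, (min (G x) N) ^ p ∂W) ^ (1 / p) ≤ K := by
    intro N
    set Y := ∫⁻ x, (min (G x) N) ^ p ∂W with hY
    have hYt : Y ≠ ⊤ := by
      refine ne_top_of_le_ne_top ?_ (lintegral_mono fun x =>
        ENNReal.rpow_le_rpow (min_le_right (G x) (N : ℝ≥0∞)) hp0.le)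
      rw [lintegral_const]
      exact ENNReal.mul_ne_top (ENNReal.rpow_ne_top_of_nonneg hp0.le (ENNReal.natCast_ne_top N))
        (measure_ne_top _ _)
    by_cases hY0 : Y = 0
    · rw [hY0, ENNReal.zero_rpow_of_pos (by positivity)]; exact zero_le
    have h1 := h (fun x => (min (G x) N) ^ (p - 1)) (by fun_prop)
    have e : ∀ x, ((min (G x) (N : ℝ≥0∞)) ^ (p - 1)) ^ q = (min (G x) N) ^ p := fun x => by
      rw [← ENNReal.rpow_mul, hpq.sub_one_mul_conj]
    simp only [e] at h1
    have h2 : Y ≤ K * Y ^ (1 / q) := by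
      refine le_trans (lintegral_mono fun x => ?_) h1
      conv_lhs => rw [show p = 1 + (p - 1) by ring]
      rw [ENNReal.rpow_add_of_nonneg _ _ zero_le_one hp1.le, ENNReal.rpow_one]
      gcongr
      exact min_le_left _ _
    have e2 : Y = Y ^ (1 / p) * Y ^ (1 / q) := by
      rw [← ENNReal.rpow_add _ _ hY0 hYt, one_div, one_div, hpq.inv_add_inv_eq_one,
        ENNReal.rpow_one]
    have hne : Y ^ (1 / q) ≠ 0 := by simp [hY0, hYt]
    have hnt : Y ^ (1 / q) ≠ ⊤ := ENNReal.rpow_ne_top_of_nonneg (by positivity) hYt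
    rw [e2] at h2
    conv_rhs at h2 => rw [← e2]
    exact (ENNReal.mul_le_mul_iff_left hne hnt).1 h2
  have hlim : Tendsto (fun N : ℕ => ∫⁻ x, (min (G x) N) ^ p ∂W) atTop (𝓝 (∫⁻ x, G x ^ p ∂W)) := by
    refine lintegral_tendsto_of_tendsto_of_monotone (fun N => by fun_prop) ?_ ?_
    · refine ae_of_all _ fun x M N hMN => ?_
      simp only []
      gcongr
    · refine ae_of_all _ fun x => ?_
      refine (ENNReal.continuous_rpow_const.tendsto _).comp ?_
      have := (tendsto_const_nhds (x := G x)).min ENNReal.tendsto_nat_nhds_top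
      simpa using this
  exact le_of_tendsto ((ENNReal.continuous_rpow_const.tendsto _).comp hlim)
    (Eventually.of_forall key)

theorem carlesonBox_subset_ball (θ₀ s : ℝ) : carlesonBox θ₀ s ⊆ ball 0 1 := fun z hz => by
  simpa using hz.1

theorem carlesonBox_zero_one : carlesonBox 0 1 = ball 0 1 := by
  refine subset_antisymm (carlesonBox_subset_ball 0 1) fun z hz => ?_
  have hz' : ‖z‖ < 1 := by simpa using hz
  refine ⟨hz', ‖z‖, Complex.arg z, norm_nonneg z, (Complex.norm_mul_exp_arg_mul_I z).symm, ?_, ?_⟩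
  · linarith [norm_nonneg z]
  · simpa using Complex.abs_arg_le_pi z

/-- The positive operator on the disk dominated by the dyadic boxes of the grid shifted by `τ`. -/
def dyadicOperator (τ : ℝ) (f : ℂ → ℝ≥0∞) (z : ℂ) : ℝ≥0∞ :=
  ∑' i, (ENNReal.ofReal (2 ^ i.1)⁻¹ ^ 2)⁻¹ *
    (((dyadicFamily τ).box i).indicator 1 z * ∫⁻ w in (dyadicFamily τ).box i, f w)

theorem measurable_dyadicOperator (τ : ℝ) (f : ℂ → ℝ≥0∞) : Measurable (dyadicOperator τ f) := by
  refine Measurable.tsum fun i => Measurable.const_mul (Measurable.mul_const ?_ _) _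
  exact measurable_one.indicator ((dyadicFamily τ).measurableSet_box i)

theorem dyadicBox_subset_ball (τ : ℝ) (i : Σ k : ℕ, Fin (2 ^ k)) :
    (dyadicFamily τ).box i ⊆ ball 0 1 := fun z hz => by
  simpa using hz.1

theorem setLIntegral_indicator_one_mul {X : Type*} [MeasurableSpace X] {μ : Measure X} {E D : Set X}
    (hE : MeasurableSet E) (hED : E ⊆ D) (f : X → ℝ≥0∞) :
    ∫⁻ x in D, E.indicator 1 x * f x ∂μ = ∫⁻ x in E, f x ∂μ := by
  have : ∀ x, E.indicator 1 x * f x = E.indicator f x := fun x => by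
    by_cases hx : x ∈ E <;> simp [hx]
  simp_rw [this]
  rw [setLIntegral_indicator hE, inter_eq_self_of_subset_left hED]

theorem lintegral_absKernel_le {f : ℂ → ℝ≥0∞} (hf : Measurable f) {z : ℂ} (hz : z ∈ ball (0 : ℂ) 1) :
    ∫⁻ w in ball 0 1, absKernel z w * f w ≤
      16 * (dyadicOperator 0 f z + dyadicOperator (1 / 3) f z) := by
  have hz' : ‖z‖ < 1 := by simpa using hz
  have hD : ∀ τ : ℝ, ∀ a : ℂ → ℝ≥0∞, (a = fun w => ∑' i, (ENNReal.ofReal (2 ^ i.1)⁻¹ ^ 2)⁻¹ *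
      (((dyadicFamily τ).box i).indicator 1 z * ((dyadicFamily τ).box i).indicator 1 w)) →
      Measurable a ∧ ∫⁻ w in ball 0 1, a w * f w = dyadicOperator τ f z := by
    rintro τ _ rfl
    have hm : ∀ i, Measurable fun w : ℂ => ((dyadicFamily τ).box i).indicator (1 : ℂ → ℝ≥0∞) w :=
      fun i => measurable_one.indicator ((dyadicFamily τ).measurableSet_box i)
    refine ⟨Measurable.tsum fun i => Measurable.const_mul ((hm i).const_mul _) _, ?_⟩
    simp_rw [← ENNReal.tsum_mul_right]
    rw [lintegral_tsum fun i => by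
      have := hm i
      fun_prop]
    refine tsum_congr fun i => ?_
    simp_rw [mul_assoc]
    rw [lintegral_const_mul _ (by have := hm i; fun_prop),
      lintegral_const_mul _ (by have := hm i; fun_prop)]
    congr 2
    exact setLIntegral_indicator_one_mul ((dyadicFamily τ).measurableSet_box i)
      (dyadicBox_subset_ball τ i) f
  obtain ⟨a₀, ha₀, m0, h0⟩ : ∃ a : ℂ → ℝ≥0∞, (∀ w, a w = ∑' i, (ENNReal.ofReal (2 ^ i.1)⁻¹ ^ 2)⁻¹ *
      (((dyadicFamily 0).box i).indicator 1 z * ((dyadicFamily 0).box i).indicator 1 w)) ∧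
      Measurable a ∧ ∫⁻ w in ball 0 1, a w * f w = dyadicOperator 0 f z :=
    ⟨_, fun _ => rfl, hD 0 _ rfl⟩
  obtain ⟨a₁, ha₁, m1, h1⟩ : ∃ a : ℂ → ℝ≥0∞, (∀ w, a w = ∑' i, (ENNReal.ofReal (2 ^ i.1)⁻¹ ^ 2)⁻¹ *
      (((dyadicFamily (1 / 3)).box i).indicator 1 z *
        ((dyadicFamily (1 / 3)).box i).indicator 1 w)) ∧
      Measurable a ∧ ∫⁻ w in ball 0 1, a w * f w = dyadicOperator (1 / 3) f z :=
    ⟨_, fun _ => rfl, hD (1 / 3) _ rfl⟩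
  have n0 : Measurable fun w => a₀ w * f w := m0.mul hf
  rw [← h0, ← h1, ← lintegral_add_left n0, ← lintegral_const_mul _ (by fun_prop)]
  refine setLIntegral_mono_ae' measurableSet_ball (ae_of_all _ fun w hw => ?_)
  have hw' : ‖w‖ < 1 := by simpa using hw
  refine (mul_le_mul_left (absKernel_le hz' hw') _).trans (le_of_eq ?_)
  rw [ha₀, ha₁]
  ring

/-- The sharp weighted estimate for the maximal Bergman projection of the disk. -/
theorem exists_disk_estimate {p q : ℝ} (hpq : p.HolderConjugate q) :
    ∃ C : ℝ≥0∞, C ≠ ⊤ ∧ ∀ (ω : ℂ → ℝ≥0∞) (B : ℝ≥0∞), Measurable ω → (∀ z, ω z ≠ 0) →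
      (∀ z, ω z ≠ ⊤) → B ≠ ⊤ →
      (∀ θ s : ℝ, 0 < s → s ≤ 1 → (∫⁻ z in carlesonBox θ s, ω z) *
        (∫⁻ z in carlesonBox θ s, ω z ^ (-(1 / (p - 1)))) ^ (p - 1) ≤
          B * volume (carlesonBox θ s) ^ p) →
      ∀ f : ℂ → ℝ≥0∞, Measurable f →
        (∫⁻ z in ball 0 1, (∫⁻ w in ball 0 1, absKernel z w * f w) ^ p * ω z) ^ (1 / p) ≤
          C * B ^ max 1 (1 / (p - 1)) * (∫⁻ z in ball 0 1, f z ^ p * ω z) ^ (1 / p) := by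
  have hp0 : 0 < p := hpq.pos
  have hq0 : 0 < q := hpq.symm.pos
  have hp1 : 0 < p - 1 := hpq.sub_one_pos
  set κ : ℝ≥0∞ := ENNReal.ofReal (Real.pi * (1 + Real.pi) ^ 2) with hκ
  set a : ℝ := max 1 (1 / (p - 1)) with ha
  have ha0 : 0 < a := lt_max_of_lt_left one_pos
  set C₀ : ℝ≥0∞ := (κ ^ p) ^ a * 256 ^ (p + q) *
    (NestedFamily.embeddingConst p * NestedFamily.embeddingConst q) with hC₀
  have hemb : ∀ {r : ℝ}, 0 < r → NestedFamily.embeddingConst r ≠ ⊤ := fun hr =>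
    ENNReal.rpow_ne_top_of_nonneg (by positivity) ENNReal.ofReal_ne_top
  have hC₀t : C₀ ≠ ⊤ := by
    refine ENNReal.mul_ne_top (ENNReal.mul_ne_top ?_ ?_) (ENNReal.mul_ne_top (hemb hp0) (hemb hq0))
    · exact ENNReal.rpow_ne_top_of_nonneg ha0.le (ENNReal.rpow_ne_top_of_nonneg hp0.le ENNReal.ofReal_ne_top)
    · exact ENNReal.rpow_ne_top_of_nonneg (by positivity) (by norm_num)
  -- Here `32 = 2 · 16`: two grids, each with the factor `16` of the kernel bound.
  refine ⟨32 * C₀, ENNReal.mul_ne_top (by norm_num) hC₀t, fun ω B hω hω0 hωt hBt hbox f hf => ?_⟩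
  set s : ℂ → ℝ≥0∞ := fun z => ω z ^ (-(1 / (p - 1))) with hs
  have hsm : Measurable s := by fun_prop
  have hs0 : ∀ z, s z ≠ 0 := fun z => by simp [hs, hω0, hωt]
  have hst : ∀ z, s z ≠ ⊤ := fun z => by simp [hs, hω0, hωt]
  set W := (volume.restrict (ball (0 : ℂ) 1)).withDensity ω with hW
  set S := (volume.restrict (ball (0 : ℂ) 1)).withDensity s with hS
  have hpos : ∀ g : ℂ → ℝ≥0∞, Measurable g → (∀ z, g z ≠ 0) → ∫⁻ z in ball (0 : ℂ) 1, g z ≠ 0 := by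
    intro g hg hg0 h
    rw [lintegral_eq_zero_iff hg] at h
    have h2 : volume.restrict (ball (0 : ℂ) 1) = 0 := by
      rw [← Measure.measure_univ_eq_zero]
      refine measure_mono_null (fun z _ => ?_) h
      exact hg0 z
    rw [Measure.restrict_eq_zero] at h2
    exact (measure_ball_pos volume (0 : ℂ) one_pos).ne' h2
  -- The disk is itself a Carleson box. The product of the two integrals is finite there and neither
  -- vanishes, so both are finite.
  have hfin : ∫⁻ z in ball (0 : ℂ) 1, ω z ≠ ⊤ ∧ ∫⁻ z in ball (0 : ℂ) 1, s z ≠ ⊤ := by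
    have h := hbox 0 1 one_pos le_rfl
    rw [carlesonBox_zero_one] at h
    have ht : B * volume (ball (0 : ℂ) 1) ^ p ≠ ⊤ :=
      ENNReal.mul_ne_top hBt (ENNReal.rpow_ne_top_of_nonneg hp0.le measure_ball_lt_top.ne)
    have h' := ne_top_of_le_ne_top ht h
    have h1 := hpos ω hω hω0
    have h2 := hpos s hsm hs0
    constructor
    · intro h3
      rw [h3] at h'
      refine h' (ENNReal.top_mul ?_)
      simp only [ne_eq, ENNReal.rpow_eq_zero_iff, not_or, not_and]
      exact ⟨fun h4 => absurd h4 h2, fun _ => by linarith⟩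
    · intro h3
      simp only [hs] at h3
      rw [h3, ENNReal.top_rpow_of_pos hp1] at h'
      exact h' (ENNReal.mul_top h1)
  have : IsFiniteMeasure W := isFiniteMeasure_withDensity hfin.1
  have : IsFiniteMeasure S := isFiniteMeasure_withDensity hfin.2
  have hrestr : ∀ {E : Set ℂ}, MeasurableSet E → E ⊆ ball (0 : ℂ) 1 → ∀ {g : ℂ → ℝ≥0∞},
      Measurable g → ∀ h : ℂ → ℝ≥0∞, Measurable h →
      ∫⁻ z in E, h z ∂(volume.restrict (ball (0 : ℂ) 1)).withDensity g = ∫⁻ z in E, g z * h z := by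
    intro E hE hsub g hg h hh
    rw [restrict_withDensity hE, Measure.restrict_restrict_of_subset hsub,
      lintegral_withDensity_eq_lintegral_mul _ hg hh]
    rfl
  have hmeas : ∀ {E : Set ℂ}, MeasurableSet E → E ⊆ ball (0 : ℂ) 1 → ∀ {g : ℂ → ℝ≥0∞},
      (volume.restrict (ball (0 : ℂ) 1)).withDensity g E = ∫⁻ z in E, g z := by
    intro E hE hsub g
    rw [withDensity_apply _ hE, Measure.restrict_restrict_of_subset hsub]
  have hdual : ∀ τ : ℝ, ∀ γ : ℂ → ℝ≥0∞, Measurable γ →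
      ∫⁻ z, dyadicOperator τ f z * γ z ∂W ≤ C₀ * B ^ a *
        ((∫⁻ z in ball 0 1, f z ^ p * ω z) ^ (1 / p) * (∫⁻ z, γ z ^ q ∂W) ^ (1 / q)) := by
    intro τ γ hγ
    set F := dyadicFamily τ with hF
    set m : (Σ k : ℕ, Fin (2 ^ k)) → ℝ≥0∞ := fun i => ENNReal.ofReal (2 ^ i.1)⁻¹ ^ 2 with hm
    have hm0 : ∀ i, m i ≠ 0 := fun i => by simp [hm]
    have hmt : ∀ i, m i ≠ ⊤ := fun i => ENNReal.pow_ne_top ENNReal.ofReal_ne_top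
    have hball : ∀ i, F.box i ⊆ ball 0 1 := dyadicBox_subset_ball τ
    have hBi : ∀ i, W (F.box i) * S (F.box i) ^ (p - 1) ≤ B * κ ^ p * m i ^ p := by
      intro i
      rw [hmeas (F.measurableSet_box i) (hball i), hmeas (F.measurableSet_box i) (hball i)]
      have hsub := dyadicBox_subset τ i
      have h2 := hbox (arcCentre τ i) (2 ^ i.1)⁻¹ (by positivity)
        (inv_le_one_of_one_le₀ (one_le_pow₀ one_le_two))
      calc _ ≤ _ := mul_le_mul' (lintegral_mono_set hsub)
            (ENNReal.rpow_le_rpow (lintegral_mono_set hsub) hp1.le)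
        _ ≤ _ := h2
        _ ≤ B * (κ * m i) ^ p := by
            gcongr
            exact volume_carlesonBox_le _
        _ = _ := by rw [ENNReal.mul_rpow_of_nonneg _ _ hp0.le, mul_assoc]
    -- Hölder on the top half, since `ω ^ (1/p) * s ^ (1/q) = 1` for the dual weight `s`.
    have hAi : ∀ i, m i ≤ 256 * (W (F.top i) ^ (1 / p) * S (F.top i) ^ (1 / q)) := by
      intro i
      have hti : F.top i ⊆ ball 0 1 := (F.top_subset i).trans (hball i)
      refine (le_volume_dyadicTop τ i).trans (mul_le_mul_right ?_ _)
      rw [hmeas (F.measurableSet_top i) hti, hmeas (F.measurableSet_top i) hti]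
      have h1 := ENNReal.lintegral_mul_le_Lp_mul_Lq (volume.restrict (F.top i)) hpq
        (f := fun z => ω z ^ (1 / p)) (g := fun z => s z ^ (1 / q)) (by fun_prop) (by fun_prop)
      have e1 : ∀ z, (ω z ^ (1 / p)) ^ p = ω z := fun z => by
        rw [← ENNReal.rpow_mul, one_div_mul_cancel hp0.ne', ENNReal.rpow_one]
      have e2 : ∀ z, (s z ^ (1 / q)) ^ q = s z := fun z => by
        rw [← ENNReal.rpow_mul, one_div_mul_cancel hq0.ne', ENNReal.rpow_one]
      simp only [e1, e2] at h1
      refine le_trans (le_of_eq ?_) h1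
      rw [← setLIntegral_one]
      refine lintegral_congr fun z => ?_
      simp only [Pi.mul_apply, hs]
      rw [← ENNReal.rpow_mul, ← ENNReal.rpow_add _ _ (hω0 z) (hωt z)]
      have : 1 / p + -(1 / (p - 1)) * (1 / q) = 0 := by
        rw [hpq.conjugate_eq]; field_simp; ring
      rw [this, ENNReal.rpow_zero]
    -- Dividing by the dual weight gives `φ dS = f dA` and `φ ^ p dS = f ^ p ω dA`.
    set φ : ℂ → ℝ≥0∞ := fun z => f z * (s z)⁻¹ with hφ
    have hφm : Measurable φ := by fun_prop
    have hmain := F.sparseForm_le hpq W S m hm0 hmt (by norm_num) hBi hAi hφm hγ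
    have e3 : ∀ i, ∫⁻ z in F.box i, φ z ∂S = ∫⁻ z in F.box i, f z := by
      intro i
      rw [hrestr (F.measurableSet_box i) (hball i) hsm φ hφm]
      refine lintegral_congr fun z => ?_
      simp only [hφ]
      rw [mul_left_comm, ENNReal.mul_inv_cancel (hs0 z) (hst z), mul_one]
    have e4 : ∫⁻ z, φ z ^ p ∂S = ∫⁻ z in ball 0 1, f z ^ p * ω z := by
      rw [lintegral_withDensity_eq_lintegral_mul _ hsm (by fun_prop)]
      refine lintegral_congr fun z => ?_
      simp only [Pi.mul_apply, hφ]
      rw [ENNReal.mul_rpow_of_nonneg _ _ hp0.le, mul_left_comm]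
      congr 1
      simp only [hs]
      rw [← ENNReal.rpow_neg, neg_neg, ← ENNReal.rpow_mul, ← ENNReal.rpow_add _ _ (hω0 z) (hωt z)]
      have : -(1 / (p - 1)) + 1 / (p - 1) * p = 1 := by field_simp; ring
      rw [this, ENNReal.rpow_one]
    have e5 : ∫⁻ z, dyadicOperator τ f z * γ z ∂W = ∑' i, (m i)⁻¹ *
        ((∫⁻ x in F.box i, φ x ∂S) * ∫⁻ x in F.box i, γ x ∂W) := by
      have hmi : ∀ i, Measurable ((F.box i).indicator (1 : ℂ → ℝ≥0∞)) := fun i =>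
        measurable_one.indicator (F.measurableSet_box i)
      simp_rw [dyadicOperator, ← ENNReal.tsum_mul_right]
      rw [lintegral_tsum fun i => by have := hmi i; fun_prop]
      refine tsum_congr fun i => ?_
      rw [e3, ← mul_assoc, ← setLIntegral_indicator_one_mul (μ := W) (F.measurableSet_box i)
        (subset_univ _), Measure.restrict_univ, ← lintegral_const_mul _ (by have := hmi i; fun_prop)]
      refine lintegral_congr fun z => ?_
      simp only [hm, hF]
      ring
    rw [e5]
    refine hmain.trans (le_of_eq ?_)
    rw [e4, ENNReal.mul_rpow_of_nonneg _ _ ha0.le]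
    ring
  set G : ℂ → ℝ≥0∞ := fun z => 16 * (dyadicOperator 0 f z + dyadicOperator (1 / 3) f z) with hG
  have hGm : Measurable G :=
    ((measurable_dyadicOperator 0 f).add (measurable_dyadicOperator (1 / 3) f)).const_mul _
  have hfinal := rpow_lintegral_le_of_forall_dual hpq W hGm
    (K := 32 * C₀ * B ^ a * (∫⁻ z in ball 0 1, f z ^ p * ω z) ^ (1 / p)) (by
    intro γ hγ
    have n0 : Measurable fun x => dyadicOperator 0 f x * γ x :=
      (measurable_dyadicOperator 0 f).mul hγ
    have n1 : Measurable fun x => dyadicOperator (1 / 3) f x * γ x :=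
      (measurable_dyadicOperator (1 / 3) f).mul hγ
    calc ∫⁻ x, G x * γ x ∂W = 16 * (∫⁻ x, dyadicOperator 0 f x * γ x ∂W +
          ∫⁻ x, dyadicOperator (1 / 3) f x * γ x ∂W) := by
          rw [← lintegral_add_left n0, ← lintegral_const_mul _ (by fun_prop)]
          refine lintegral_congr fun x => ?_
          simp only [hG]; ring
      _ ≤ 16 * (_ + _) := mul_le_mul_right (add_le_add (hdual 0 γ hγ) (hdual (1 / 3) γ hγ)) _
      _ = _ := by ring)
  refine le_trans (ENNReal.rpow_le_rpow ?_ (by positivity)) hfinal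
  rw [lintegral_withDensity_eq_lintegral_mul _ hω (by fun_prop)]
  refine setLIntegral_mono_ae' measurableSet_ball (ae_of_all _ fun z hz => ?_)
  simp only [Pi.mul_apply]
  rw [mul_comm (ω z)]
  gcongr
  exact lintegral_absKernel_le hf hz


/-! ### The reproducing formula of the disk -/

/-- On `|w| = ρ` one has `w̄ = ρ² / w`, so `1 - z w̄ = (w - zρ²) / w` and the integral becomes
Cauchy's formula for the derivative of `w G(w)` at `zρ²`. -/
theorem circle_integral_kernel {G : ℂ → ℂ} (hG : DifferentiableOn ℂ G (ball 0 1)) {z : ℂ}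
    (hz : ‖z‖ < 1) {ρ : ℝ} (h0 : 0 < ρ) (h1 : ρ < 1) :
    ∫ θ in Ioo (-Real.pi) Real.pi, G (Complex.polarCoord.symm (ρ, θ)) /
      (1 - z * (starRingEnd ℂ) (Complex.polarCoord.symm (ρ, θ))) ^ 2 =
      2 * Real.pi * (G (z * ρ ^ 2) + z * ρ ^ 2 * deriv G (z * ρ ^ 2)) := by
  have hpi := Real.pi_pos
  have hw0 : z * ρ ^ 2 ∈ ball (0 : ℂ) ρ := by
    rw [mem_ball_zero_iff, norm_mul, norm_pow, Complex.norm_real, Real.norm_of_nonneg h0.le]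
    nlinarith [norm_nonneg z, mul_pos h0 h0]
  have hw1 : z * ρ ^ 2 ∈ ball (0 : ℂ) 1 := ball_subset_ball h1.le hw0
  have hdiff : DifferentiableOn ℂ (fun w => w * G w) (ball 0 1) := differentiableOn_id.mul hG
  have hc := Complex.two_pi_I_inv_smul_circleIntegral_sub_sq_inv_smul_of_differentiable
    isOpen_ball (closedBall_subset_ball h1) hdiff hw0
  have hGd : DifferentiableAt ℂ G (z * ρ ^ 2) := hG.differentiableAt (isOpen_ball.mem_nhds hw1)
  have hderiv : deriv (fun w => w * G w) (z * ρ ^ 2) =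
      G (z * ρ ^ 2) + z * ρ ^ 2 * deriv G (z * ρ ^ 2) := by
    have := (hasDerivAt_id (z * (ρ : ℂ) ^ 2)).fun_mul hGd.hasDerivAt
    simpa using this.deriv
  rw [hderiv] at hc
  set f : ℂ → ℂ := fun w => G w / (1 - z * (starRingEnd ℂ) w) ^ 2 with hf
  have hmap : ∀ θ : ℝ, Complex.polarCoord.symm (ρ, θ) = circleMap 0 ρ θ := fun θ => by
    rw [Complex.polarCoord_symm_apply, circleMap, Complex.exp_mul_I]; simp
  have hint : (∮ w in C(0, ρ), ((w - z * ρ ^ 2) ^ 2)⁻¹ • (w * G w)) =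
      Complex.I * ∫ θ in (0 : ℝ)..2 * Real.pi, f (circleMap 0 ρ θ) := by
    rw [circleIntegral, ← intervalIntegral.integral_const_mul]
    refine intervalIntegral.integral_congr fun θ _ => ?_
    simp only [deriv_circleMap, smul_eq_mul, hf]
    set w := circleMap 0 ρ θ with hw
    have hn : ‖w‖ = ρ := by rw [hw]; simp [abs_of_pos h0]
    have hw00 : w ≠ 0 := by rw [← norm_ne_zero_iff, hn]; exact h0.ne'
    have hww : w * (starRingEnd ℂ) w = ρ ^ 2 := by rw [Complex.mul_conj', hn]
    have e : w - z * ρ ^ 2 = w * (1 - z * (starRingEnd ℂ) w) := by rw [← hww]; ring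
    rw [e, mul_pow, mul_inv]
    field_simp
  rw [hint] at hc
  have hper : Function.Periodic (fun θ : ℝ => f (circleMap 0 ρ θ)) (2 * Real.pi) :=
    fun θ => by simp [periodic_circleMap 0 ρ θ]
  have h2 := hper.intervalIntegral_add_eq 0 (-Real.pi)
  rw [zero_add, show -Real.pi + 2 * Real.pi = Real.pi by ring] at h2
  rw [h2, intervalIntegral.integral_of_le (by linarith), integral_Ioc_eq_integral_Ioo] at hc
  simp_rw [hmap]
  rw [← hc, smul_eq_mul]
  have : (Real.pi : ℂ) ≠ 0 := by exact_mod_cast hpi.ne'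
  field_simp [Complex.I_ne_zero]
  rfl

theorem one_sub_norm_le_norm_one_sub {z w : ℂ} (hw : ‖w‖ ≤ 1) :
    1 - ‖z‖ ≤ ‖1 - z * (starRingEnd ℂ) w‖ := by
  have := norm_sub_norm_le (1 : ℂ) (z * (starRingEnd ℂ) w)
  rw [norm_mul, RCLike.norm_conj, norm_one] at this
  nlinarith [norm_nonneg z]

/-- The reproducing property of the Bergman kernel of the disk. -/
theorem integral_mul_kernel {G : ℂ → ℂ} (hG : DifferentiableOn ℂ G (ball 0 1))
    (hGi : IntegrableOn G (ball 0 1)) {z : ℂ} (hz : ‖z‖ < 1) :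
    ∫ w in ball 0 1, G w / (1 - z * (starRingEnd ℂ) w) ^ 2 = Real.pi * G z := by
  have hne : ∀ w ∈ ball (0 : ℂ) 1, 1 - z * (starRingEnd ℂ) w ≠ 0 := fun w hw => by
    have := one_sub_norm_le_norm_one_sub (z := z) (mem_ball_zero_iff.1 hw).le
    rw [← norm_pos_iff]; linarith
  set h : ℂ → ℂ := fun w => G w / (1 - z * (starRingEnd ℂ) w) ^ 2 with hh
  have hcont : ContinuousOn h (ball 0 1) :=
    hG.continuousOn.div (by fun_prop) fun w hw => pow_ne_zero _ (hne w hw)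
  have hinth : IntegrableOn h (ball 0 1) := by
    refine (hGi.norm.const_mul ((1 - ‖z‖) ^ 2)⁻¹).mono' (hcont.aestronglyMeasurable measurableSet_ball) ?_
    filter_upwards [ae_restrict_mem measurableSet_ball] with w hw
    have h1 := one_sub_norm_le_norm_one_sub (z := z) (mem_ball_zero_iff.1 hw).le
    rw [hh, norm_div, norm_pow, div_eq_inv_mul]
    have : 0 < 1 - ‖z‖ := by linarith
    gcongr
  -- Extension by zero gives a measurable function on the plane, as polar coordinates and Fubini
  -- require.
  set f : ℂ → ℂ := (ball 0 1).indicator h with hf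
  have hfm : Measurable f := by
    classical
    rw [hf, ← piecewise_eq_indicator]
    exact hcont.measurable_piecewise continuousOn_const measurableSet_ball
  have hfi : Integrable f := hinth.integrable_indicator measurableSet_ball
  have hsymm : Continuous fun q : ℝ × ℝ => Complex.polarCoord.symm q := by
    simp only [Complex.polarCoord_symm_apply]; fun_prop
  have hpol : IntegrableOn (fun q : ℝ × ℝ => q.1 • f (Complex.polarCoord.symm q))
      (Ioi (0 : ℝ) ×ˢ Ioo (-Real.pi) Real.pi) (volume.prod volume) := by
    refine ⟨(measurable_fst.smul (hfm.comp hsymm.measurable)).aestronglyMeasurable, ?_⟩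
    have h1 := Complex.lintegral_comp_polarCoord_symm fun w => ‖f w‖ₑ
    rw [polarCoord_target] at h1
    rw [hasFiniteIntegral_iff_enorm]
    have h2 : ∫⁻ q in Ioi (0 : ℝ) ×ˢ Ioo (-Real.pi) Real.pi,
        ‖q.1 • f (Complex.polarCoord.symm q)‖ₑ ∂volume.prod volume = ∫⁻ w, ‖f w‖ₑ := by
      rw [← h1]
      refine setLIntegral_congr_fun (measurableSet_Ioi.prod measurableSet_Ioo) fun q hq => ?_
      rw [enorm_smul, Real.enorm_of_nonneg (le_of_lt hq.1), smul_eq_mul]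
    rw [h2]
    exact hasFiniteIntegral_iff_enorm.1 hfi.2
  have hDcont : ContinuousOn (fun ρ : ℝ => ρ * (2 * Real.pi *
      (G (z * ρ ^ 2) + z * ρ ^ 2 * deriv G (z * ρ ^ 2)))) (Icc 0 1) := by
    have hmaps : ∀ ρ ∈ Icc (0 : ℝ) 1, z * (ρ : ℂ) ^ 2 ∈ ball (0 : ℂ) 1 := fun ρ hρ => by
      rw [mem_ball_zero_iff, norm_mul, norm_pow, Complex.norm_real, Real.norm_of_nonneg hρ.1]
      have : ρ ^ 2 ≤ 1 := pow_le_one₀ hρ.1 hρ.2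
      nlinarith [norm_nonneg z]
    have hc1 : Continuous fun ρ : ℝ => z * (ρ : ℂ) ^ 2 := by fun_prop
    have g1 := hG.continuousOn.comp hc1.continuousOn hmaps
    have g2 := (hG.deriv isOpen_ball).continuousOn.comp hc1.continuousOn hmaps
    exact (Complex.continuous_ofReal.continuousOn).mul
      (continuousOn_const.mul (g1.add (hc1.continuousOn.mul g2)))
  -- The radial integrand is the derivative of `π ρ² G(zρ²)`. Since `|z| < 1`, the point `zρ²` stays
  -- in the open disk up to `ρ = 1`, and no boundary values of `G` enter.
  have hFTC : ∫ ρ in (0 : ℝ)..1, (ρ : ℂ) * (2 * Real.pi *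
      (G (z * ρ ^ 2) + z * ρ ^ 2 * deriv G (z * ρ ^ 2))) = Real.pi * G z := by
    have hd : ∀ ρ ∈ uIcc (0 : ℝ) 1, HasDerivAt (fun ρ : ℝ => Real.pi * (ρ : ℂ) ^ 2 * G (z * ρ ^ 2))
        ((ρ : ℂ) * (2 * Real.pi * (G (z * ρ ^ 2) + z * ρ ^ 2 * deriv G (z * ρ ^ 2)))) ρ := by
      intro ρ hρ
      rw [uIcc_of_le zero_le_one] at hρ
      have hm : z * (ρ : ℂ) ^ 2 ∈ ball (0 : ℂ) 1 := by
        rw [mem_ball_zero_iff, norm_mul, norm_pow, Complex.norm_real, Real.norm_of_nonneg hρ.1]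
        have : ρ ^ 2 ≤ 1 := pow_le_one₀ hρ.1 hρ.2
        nlinarith [norm_nonneg z]
      have hGd := (hG.differentiableAt (isOpen_ball.mem_nhds hm)).hasDerivAt
      have hp : HasDerivAt (fun x : ℂ => x ^ 2) (2 * (ρ : ℂ)) ρ := by
        simpa using hasDerivAt_pow 2 (ρ : ℂ)
      have h3 : HasDerivAt (fun x : ℂ => z * x ^ 2) (z * (2 * ρ)) ρ := hp.const_mul z
      have h4 := ((hp.const_mul (Real.pi : ℂ)).mul
        (HasDerivAt.comp (h₂ := G) (ρ : ℂ) hGd h3)).comp_ofReal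
      refine h4.congr_deriv ?_
      simp only [Function.comp_apply]
      ring
    rw [intervalIntegral.integral_eq_sub_of_hasDerivAt hd
      (ContinuousOn.intervalIntegrable (by rwa [uIcc_of_le zero_le_one]))]
    simp
  calc ∫ w in ball 0 1, h w = ∫ w, f w := (integral_indicator measurableSet_ball).symm
    _ = ∫ q in Ioi (0 : ℝ) ×ˢ Ioo (-Real.pi) Real.pi,
          q.1 • f (Complex.polarCoord.symm q) ∂volume.prod volume := by
        rw [← Complex.integral_comp_polarCoord_symm, polarCoord_target]; rfl
    _ = ∫ ρ in Ioi (0 : ℝ), ∫ θ in Ioo (-Real.pi) Real.pi,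
          ρ • f (Complex.polarCoord.symm (ρ, θ)) := setIntegral_prod _ hpol
    _ = ∫ ρ in Ioi (0 : ℝ), (Ioo (0 : ℝ) 1).indicator (fun ρ => (ρ : ℂ) * (2 * Real.pi *
          (G (z * ρ ^ 2) + z * ρ ^ 2 * deriv G (z * ρ ^ 2)))) ρ := by
        refine setIntegral_congr_fun measurableSet_Ioi fun ρ hρ => ?_
        have hρ0 : (0 : ℝ) < ρ := hρ
        have hn : ∀ θ, ‖Complex.polarCoord.symm (ρ, θ)‖ = ρ := fun θ => by
          rw [Complex.norm_polarCoord_symm]; exact abs_of_pos hρ0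
        rw [integral_smul]
        by_cases h1 : ρ < 1
        · rw [indicator_of_mem (show ρ ∈ Ioo (0 : ℝ) 1 from ⟨hρ0, h1⟩),
            ← circle_integral_kernel hG hz hρ0 h1, Complex.real_smul]
          congr 1
          refine integral_congr_ae (ae_of_all _ fun θ => ?_)
          simp only [hf]
          rw [indicator_of_mem]
          rw [mem_ball_zero_iff, hn]; exact h1
        · rw [indicator_of_notMem (fun h => h1 h.2)]
          have : ∀ θ, f (Complex.polarCoord.symm (ρ, θ)) = 0 := fun θ => by
            rw [hf, indicator_of_notMem]
            rw [mem_ball_zero_iff, hn]; exact h1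
          simp_rw [this]
          simp
    _ = Real.pi * G z := by
        rw [setIntegral_indicator measurableSet_Ioo, inter_eq_self_of_subset_right Ioo_subset_Ioi_self,
          ← integral_Ioc_eq_integral_Ioo, ← intervalIntegral.integral_of_le zero_le_one, hFTC]


/-! ### Conformal changes of variables -/

/-- The real determinant of multiplication by `d` is the algebra norm of `d` over `ℝ`. -/
theorem abs_det_smul_one (d : ℂ) : |(d • (1 : ℂ →L[ℝ] ℂ)).det| = ‖d‖ ^ 2 := by
  have : ((d • (1 : ℂ →L[ℝ] ℂ) : ℂ →L[ℝ] ℂ) : ℂ →ₗ[ℝ] ℂ) = Algebra.lmul ℝ ℂ d := by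
    ext; simp
  rw [ContinuousLinearMap.det, this, ← Algebra.norm_apply, Algebra.norm_complex_apply,
    Complex.normSq_eq_norm_sq, abs_of_nonneg (sq_nonneg _)]

theorem enorm_div_of_ne_zero (a : ℂ) {b : ℂ} (hb : b ≠ 0) : ‖a / b‖ₑ = ‖a‖ₑ / ‖b‖ₑ := by
  rw [div_eq_mul_inv, enorm_mul, enorm_inv hb, div_eq_mul_inv]

namespace IsConformalOnto

variable {ψ : ℂ → ℂ} {Ω : Set ℂ}

theorem hasDerivAt (h : IsConformalOnto ψ Ω) {z : ℂ} (hz : z ∈ ball (0 : ℂ) 1) :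
    HasDerivAt ψ (deriv ψ z) z :=
  (h.1.differentiableAt (isOpen_ball.mem_nhds hz)).hasDerivAt

theorem continuousOn_deriv (h : IsConformalOnto ψ Ω) : ContinuousOn (deriv ψ) (ball 0 1) :=
  (h.1.deriv isOpen_ball).continuousOn

theorem hasFDerivWithinAt (h : IsConformalOnto ψ Ω) {E : Set ℂ} (hE : E ⊆ ball 0 1) :
    ∀ z ∈ E, HasFDerivWithinAt ψ (deriv ψ z • (1 : ℂ →L[ℝ] ℂ)) E z := fun _ hz =>
  (h.hasDerivAt (hE hz)).complexToReal_fderiv.hasFDerivWithinAt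

theorem lintegral_image (h : IsConformalOnto ψ Ω) {E : Set ℂ} (hEm : MeasurableSet E)
    (hE : E ⊆ ball 0 1) (g : ℂ → ℝ≥0∞) :
    ∫⁻ z in ψ '' E, g z = ∫⁻ z in E, ENNReal.ofReal (‖deriv ψ z‖ ^ 2) * g (ψ z) := by
  rw [lintegral_image_eq_lintegral_abs_det_fderiv_mul volume hEm (h.hasFDerivWithinAt hE)
    (h.2.injOn.mono hE)]
  simp_rw [abs_det_smul_one]

theorem lintegral_eq (h : IsConformalOnto ψ Ω) (g : ℂ → ℝ≥0∞) :
    ∫⁻ z in Ω, g z = ∫⁻ z in ball 0 1, ENNReal.ofReal (‖deriv ψ z‖ ^ 2) * g (ψ z) := by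
  rw [← h.lintegral_image measurableSet_ball subset_rfl, h.2.image_eq]

theorem integral_eq (h : IsConformalOnto ψ Ω) (g : ℂ → ℂ) :
    ∫ z in Ω, g z = ∫ z in ball 0 1, ‖deriv ψ z‖ ^ 2 • g (ψ z) := by
  rw [← h.2.image_eq, integral_image_eq_integral_abs_det_fderiv_smul volume measurableSet_ball
    (h.hasFDerivWithinAt subset_rfl) h.2.injOn]
  simp_rw [abs_det_smul_one]

/-- By isolation of zeros, the alternative is that `ψ'` vanishes near `z`; then `ψ` is constant on a
disk, against injectivity. -/
theorem eventually_deriv_ne_zero (h : IsConformalOnto ψ Ω) {z : ℂ} (hz : z ∈ ball (0 : ℂ) 1) :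
    ∀ᶠ w in 𝓝[≠] z, deriv ψ w ≠ 0 := by
  have han : AnalyticAt ℂ (deriv ψ) z :=
    (h.1.deriv isOpen_ball).analyticAt (isOpen_ball.mem_nhds hz)
  rcases han.eventually_eq_zero_or_eventually_ne_zero with h0 | h0
  · exfalso
    obtain ⟨r, hr, hsub⟩ := Metric.eventually_nhds_iff_ball.1
      (h0.and (isOpen_ball.eventually_mem hz))
    have hconst : ∀ w ∈ ball z r, ψ w = ψ z := fun w hw =>
      (convex_ball z r).is_const_of_fderivWithin_eq_zero (𝕜 := ℂ)
        (fun x hx => (h.hasDerivAt (hsub x hx).2).differentiableAt.differentiableWithinAt)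
        (fun x hx => by
          rw [(h.hasDerivAt (hsub x hx).2).hasFDerivAt.hasFDerivWithinAt.fderivWithin
            (isOpen_ball.uniqueDiffWithinAt hx), (hsub x hx).1]
          simp) hw (mem_ball_self hr)
    have hw : z + (r / 2 : ℝ) ∈ ball z r := by
      rw [mem_ball, dist_self_add_left, Complex.norm_real, Real.norm_of_nonneg (by positivity)]
      linarith
    have := h.2.injOn (hsub _ hw).2 hz (hconst _ hw)
    have hr2 : ((r / 2 : ℝ) : ℂ) = 0 := by simpa using this
    have : r / 2 = 0 := by exact_mod_cast hr2
    linarith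
  · exact h0

/-- Finiteness of the `B_1` characteristic on the box equal to the whole disk makes `|ψ'|⁻²`
essentially bounded, whereas it would blow up at a zero of `ψ'`. -/
theorem deriv_ne_zero (h : IsConformalOnto ψ Ω)
    (hJ : diskChar 1 (fun z => ‖deriv ψ z‖ ^ 2) < ⊤) {z : ℂ} (hz : z ∈ ball (0 : ℂ) 1) :
    deriv ψ z ≠ 0 := by
  set J : ℂ → ℝ := fun z => ‖deriv ψ z‖ ^ 2 with hJdef
  have hJc : ContinuousOn J (ball 0 1) := h.continuousOn_deriv.norm.pow 2
  have hbox : bekolleProduct 1 J (ball 0 1) < ⊤ := by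
    refine lt_of_le_of_lt ?_ hJ
    rw [← carlesonBox_zero_one, diskChar]
    exact le_iSup_of_le 0 (le_iSup_of_le 1 (le_iSup_of_le ⟨one_pos, le_rfl⟩ le_rfl))
  have hVt : volume (ball (0 : ℂ) 1) ≠ ⊤ := measure_ball_lt_top.ne
  have hV0 : volume (ball (0 : ℂ) 1) ≠ 0 := (measure_ball_pos volume (0 : ℂ) one_pos).ne'
  -- A property true almost everywhere holds at points arbitrarily close to `x`, where it can be
  -- confronted with a limit.
  have hne : ∀ x ∈ ball (0 : ℂ) 1, ∀ P : ℂ → Prop,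
      (∀ᵐ w ∂volume.restrict (ball (0 : ℂ) 1), P w) → ∃ᶠ w in 𝓝[≠] x, P w := by
    intro x hx P hP hcon
    have h1 : ∀ᶠ w in 𝓝[≠] x, ¬ P w ∧ w ∈ ball (0 : ℂ) 1 :=
      hcon.and (mem_nhdsWithin_of_mem_nhds (isOpen_ball.mem_nhds hx))
    rw [eventually_nhdsWithin_iff, Metric.eventually_nhds_iff_ball] at h1
    obtain ⟨r, hr, hsub⟩ := h1
    rw [ae_restrict_iff' measurableSet_ball] at hP
    have h2 : volume (ball x r \ {x}) = 0 := by
      refine measure_mono_null (fun w hw => ?_) hP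
      have := hsub w hw.1 hw.2
      exact fun hc => this.1 (hc this.2)
    rw [measure_sdiff_null (measure_singleton x)] at h2
    exact (measure_ball_pos volume x hr).ne' h2
  -- A zero average would hide an infinite second factor, because `0 * ⊤ = 0`.
  have hA : localAverage 1 J (ball 0 1) ≠ 0 := by
    intro h0
    simp only [localAverage, ENNReal.div_eq_zero_iff] at h0
    rcases h0 with h0 | h0
    · rw [eLpNorm_eq_zero_iff (hJc.aestronglyMeasurable measurableSet_ball) one_ne_zero] at h0
      obtain ⟨w, hw, hw'⟩ := ((hne 0 (mem_ball_self one_pos) _ h0).and_eventually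
        (h.eventually_deriv_ne_zero (mem_ball_self one_pos))).exists
      simp [hJdef, hw'] at hw
    · simp at h0
  have hB : eLpNorm (fun z => (J z)⁻¹) ⊤ (volume.restrict (ball 0 1)) ≠ ⊤ := by
    intro ht
    rw [bekolleProduct, lt_top_iff_ne_top] at hbox
    refine hbox ?_
    rw [show localAverage (ENNReal.ofReal (1 - 1))⁻¹ (fun z => (J z)⁻¹) (ball 0 1) = ⊤ by
      simp [localAverage, ht]]
    exact ENNReal.mul_top hA
  intro hz0
  set κ := eLpNorm (fun z => (J z)⁻¹) ⊤ (volume.restrict (ball 0 1)) with hκ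
  have hae : ∀ᵐ w ∂volume.restrict (ball (0 : ℂ) 1), ‖(J w)⁻¹‖ₑ ≤ κ := by
    rw [hκ, eLpNorm_exponent_top]; exact ae_le_eLpNormEssSup
  have hlim : Tendsto J (𝓝[≠] z) (𝓝[>] 0) := by
    refine tendsto_nhdsWithin_iff.2 ⟨?_, ?_⟩
    · have : J z = 0 := by simp [hJdef, hz0]
      rw [← this]
      exact (hJc.continuousAt (isOpen_ball.mem_nhds hz)).tendsto.mono_left nhdsWithin_le_nhds
    · filter_upwards [h.eventually_deriv_ne_zero hz] with w hw
      exact pow_pos (norm_pos_iff.2 hw) 2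
  have hlarge := (tendsto_inv_nhdsGT_zero.comp hlim).eventually_gt_atTop κ.toReal
  obtain ⟨w, hw1, hw2⟩ := ((hne z hz _ hae).and_eventually hlarge).exists
  simp only [Function.comp_apply] at hw2
  have h3 := ENNReal.toReal_mono hB hw1
  rw [toReal_enorm] at h3
  exact (hw2.trans_le ((le_abs_self _).trans h3)).false

/-- The inverse of the conformal map. -/
def inv (_ : IsConformalOnto ψ Ω) : ℂ → ℂ := Function.invFunOn ψ (ball 0 1)

theorem inv_apply (h : IsConformalOnto ψ Ω) {z : ℂ} (hz : z ∈ ball (0 : ℂ) 1) :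
    h.inv (ψ z) = z := h.2.injOn.leftInvOn_invFunOn hz

theorem differentiableOn_comp_inv (h : IsConformalOnto ψ Ω)
    (hd : ∀ z ∈ ball (0 : ℂ) 1, deriv ψ z ≠ 0) {g : ℂ → ℂ} (hg : DifferentiableOn ℂ g (ball 0 1)) :
    DifferentiableOn ℂ (fun w => g (h.inv w)) Ω := by
  intro ζ hζ
  obtain ⟨z, hz, rfl⟩ := h.2.surjOn hζ
  have hs : HasStrictDerivAt ψ (deriv ψ z) z :=
    (h.1.analyticAt (isOpen_ball.mem_nhds hz)).hasStrictDerivAt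
  have hi := hs.to_local_left_inverse (hd z hz) (g := h.inv)
    ((isOpen_ball.eventually_mem hz).mono fun x hx => h.inv_apply hx)
  have hgz : DifferentiableAt ℂ g (h.inv (ψ z)) := by
    rw [h.inv_apply hz]; exact hg.differentiableAt (isOpen_ball.mem_nhds hz)
  exact (hgz.comp (ψ z) hi.hasDerivAt.differentiableAt).differentiableWithinAt

end IsConformalOnto

/-- The Bergman projection is dominated, in the coordinates of the disk, by the maximal Bergman
projection. -/
theorem enorm_bergmanProjection_le {ψ : ℂ → ℂ} {Ω : TopologicalSpace.Opens ℂ}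
    (h : IsConformalOnto ψ Ω) (hd : ∀ z ∈ ball (0 : ℂ) 1, deriv ψ z ≠ 0) {f g : ℂ → ℂ}
    (hf : MemLp f 2 (volume.restrict (Ω : Set ℂ))) (hg : DifferentiableOn ℂ g Ω)
    (hfg : bergmanProjection Ω (hf.toLp f) =ᵐ[volume.restrict (Ω : Set ℂ)] g) {z : ℂ}
    (hz : z ∈ ball (0 : ℂ) 1) :
    ‖g (ψ z)‖ₑ * ‖deriv ψ z‖ₑ ≤
      ∫⁻ w in ball 0 1, absKernel z w * (‖f (ψ w)‖ₑ * ‖deriv ψ w‖ₑ) := by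
  have hz' : ‖z‖ < 1 := mem_ball_zero_iff.1 hz
  have hpsi : ∀ w ∈ ball (0 : ℂ) 1, ψ w ∈ (Ω : Set ℂ) := fun w hw => h.2.mapsTo hw
  set k : ℂ → ℂ := fun w => ((1 - w * (starRingEnd ℂ) z) ^ 2)⁻¹ with hk
  have hconj : ∀ w, (starRingEnd ℂ) (k w) = ((1 - z * (starRingEnd ℂ) w) ^ 2)⁻¹ := fun w => by
    simp [hk, mul_comm]
  have hknorm : ∀ w, ‖k w‖ₑ = absKernel z w := fun w => by
    rw [← RCLike.enorm_conj, hconj, absKernel, ← norm_pow, ← norm_inv, ofReal_norm]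
  have hkd : DifferentiableOn ℂ k (ball 0 1) := by
    refine DifferentiableOn.inv (by fun_prop) fun w hw => pow_ne_zero 2 ?_
    have h1 := one_sub_norm_le_norm_one_sub (z := w) hz'.le
    have : ‖w‖ < 1 := mem_ball_zero_iff.1 hw
    rw [← norm_pos_iff]; linarith
  have hdd : DifferentiableOn ℂ (deriv ψ) (ball 0 1) := h.1.deriv isOpen_ball
  -- Up to the constant `π` times the conjugate of `ψ'(z)`, this is the Bergman kernel of `Ω` at
  -- `ψ(z)`. Pairing it with `f` and with the projection of `f` gives the same value, and the latter
  -- is `π G(z)`.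
  set u : ℂ → ℂ := fun ζ => (fun w => k w / deriv ψ w) (h.inv ζ) with hu
  have hud : DifferentiableOn ℂ u Ω := h.differentiableOn_comp_inv hd (hkd.div hdd hd)
  have huψ : ∀ w ∈ ball (0 : ℂ) 1, u (ψ w) = k w / deriv ψ w := fun w hw => by
    simp only [hu, h.inv_apply hw]
  have hkb : ∀ w ∈ ball (0 : ℂ) 1, absKernel z w ≤ ENNReal.ofReal ((1 - ‖z‖) ^ 2)⁻¹ := by
    intro w hw
    have h1 := one_sub_norm_le_norm_one_sub (z := z) (mem_ball_zero_iff.1 hw).le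
    have : 0 < 1 - ‖z‖ := by linarith
    unfold absKernel
    gcongr
  have hΩm : MeasurableSet (Ω : Set ℂ) := Ω.isOpen.measurableSet
  have hnd : ∀ w, ENNReal.ofReal (‖deriv ψ w‖ ^ 2) = ‖deriv ψ w‖ₑ ^ 2 := fun w => by
    rw [ENNReal.ofReal_pow (norm_nonneg _), ofReal_norm]
  have hnd0 : ∀ w ∈ ball (0 : ℂ) 1, ‖deriv ψ w‖ₑ ≠ 0 := fun w hw => by simpa using hd w hw
  have huL : MemLp u 2 (volume.restrict (Ω : Set ℂ)) := by
    refine ⟨hud.continuousOn.aestronglyMeasurable hΩm, ?_⟩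
    rw [eLpNorm_lt_top_iff_lintegral_rpow_enorm_lt_top two_ne_zero ENNReal.ofNat_ne_top,
      h.lintegral_eq]
    refine lt_of_le_of_lt (setLIntegral_mono_ae' measurableSet_ball (g := fun _ =>
      ENNReal.ofReal ((1 - ‖z‖) ^ 2)⁻¹ ^ 2) (ae_of_all _ fun w hw => ?_)) ?_
    · rw [huψ w hw, hnd, ENNReal.toReal_ofNat, ENNReal.rpow_ofNat, enorm_div_of_ne_zero _ (hd w hw), hknorm,
        ← mul_pow, ENNReal.mul_div_cancel (hnd0 w hw) enorm_ne_top]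
      gcongr
      exact hkb w hw
    · rw [setLIntegral_const]
      exact ENNReal.mul_lt_top (ENNReal.pow_lt_top ENNReal.ofReal_lt_top) measure_ball_lt_top
  have hgL : MemLp g 2 (volume.restrict (Ω : Set ℂ)) :=
    (memLp_congr_ae hfg).1 (Lp.memLp _)
  have horth : ∫ ζ in (Ω : Set ℂ), (starRingEnd ℂ) (u ζ) * f ζ =
      ∫ ζ in (Ω : Set ℂ), (starRingEnd ℂ) (u ζ) * g ζ := by
    have hU : huL.toLp u ∈ bergmanSpace Ω := ⟨u, hud, huL.coeFn_toLp⟩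
    have h1 := Submodule.starProjection_inner_eq_zero (K := bergmanSpace Ω) (hf.toLp f) _ hU
    rw [← inner_conj_symm, map_eq_zero, inner_sub_right, sub_eq_zero, L2.inner_def, L2.inner_def] at h1
    have e1 : ∀ (F : Lp ℂ 2 (volume.restrict (Ω : Set ℂ))) (v : ℂ → ℂ),
        F =ᵐ[volume.restrict (Ω : Set ℂ)] v → ∫ ζ in (Ω : Set ℂ), inner ℂ (huL.toLp u ζ) (F ζ) =
          ∫ ζ in (Ω : Set ℂ), (starRingEnd ℂ) (u ζ) * v ζ := by
      intro F v hFv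
      refine integral_congr_ae ?_
      filter_upwards [hFv, huL.coeFn_toLp] with ζ h2 h3
      rw [h2, h3, RCLike.inner_apply, mul_comm]
    rw [e1 _ f hf.coeFn_toLp] at h1
    exact h1.trans (e1 _ g hfg)
  set G : ℂ → ℂ := fun w => g (ψ w) * deriv ψ w with hG
  have hGd : DifferentiableOn ℂ G (ball 0 1) := (hg.comp h.1 hpsi).mul hdd
  have hGi : IntegrableOn G (ball 0 1) := by
    have : IsFiniteMeasure (volume.restrict (ball (0 : ℂ) 1)) :=
      ⟨by rw [Measure.restrict_apply_univ]; exact measure_ball_lt_top⟩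
    have hGL : MemLp G 2 (volume.restrict (ball (0 : ℂ) 1)) := by
      refine ⟨hGd.continuousOn.aestronglyMeasurable measurableSet_ball, ?_⟩
      rw [eLpNorm_lt_top_iff_lintegral_rpow_enorm_lt_top two_ne_zero ENNReal.ofNat_ne_top]
      have h1 := hgL.2
      rw [eLpNorm_lt_top_iff_lintegral_rpow_enorm_lt_top two_ne_zero ENNReal.ofNat_ne_top,
        h.lintegral_eq] at h1
      refine lt_of_le_of_lt (le_of_eq (lintegral_congr fun w => ?_)) h1
      rw [hnd, ENNReal.toReal_ofNat, ENNReal.rpow_ofNat, ENNReal.rpow_ofNat, enorm_mul, mul_pow,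
        mul_comm]
    exact hGL.integrable one_le_two
  have hrep := integral_mul_kernel hGd hGi hz'
  have e2 : ∫ ζ in (Ω : Set ℂ), (starRingEnd ℂ) (u ζ) * g ζ = Real.pi * G z := by
    rw [← hrep, h.integral_eq]
    refine setIntegral_congr_fun measurableSet_ball fun w hw => ?_
    simp only [hG]
    rw [huψ w hw, map_div₀, hconj, Complex.real_smul]
    have hne : (starRingEnd ℂ) (deriv ψ w) ≠ 0 := (map_ne_zero _).2 (hd w hw)
    have : ((‖deriv ψ w‖ ^ 2 : ℝ) : ℂ) = deriv ψ w * (starRingEnd ℂ) (deriv ψ w) := by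
      rw [Complex.mul_conj']; push_cast; rfl
    rw [this]
    field_simp
  rw [e2] at horth
  have hle := enorm_integral_le_lintegral_enorm (μ := volume.restrict (Ω : Set ℂ))
    (fun ζ => (starRingEnd ℂ) (u ζ) * f ζ)
  rw [horth, h.lintegral_eq] at hle
  have hpi1 : (1 : ℝ≥0∞) ≤ ‖(Real.pi : ℂ)‖ₑ := by
    rw [← ofReal_norm, Complex.norm_real, Real.norm_of_nonneg Real.pi_pos.le,
      ENNReal.one_le_ofReal]
    linarith [Real.pi_gt_three]
  calc ‖g (ψ z)‖ₑ * ‖deriv ψ z‖ₑ = 1 * ‖G z‖ₑ := by rw [one_mul, hG, enorm_mul]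
    _ ≤ ‖(Real.pi : ℂ) * G z‖ₑ := by
      rw [enorm_mul (Real.pi : ℂ) (G z)]; exact mul_le_mul_left hpi1 _
    _ ≤ _ := hle
    _ = _ := by
      refine setLIntegral_congr_fun measurableSet_ball fun w hw => ?_
      rw [enorm_mul, RCLike.enorm_conj, huψ w hw, hnd, enorm_div_of_ne_zero _ (hd w hw), hknorm, sq,
        show ‖deriv ψ w‖ₑ * ‖deriv ψ w‖ₑ * (absKernel z w / ‖deriv ψ w‖ₑ * ‖f (ψ w)‖ₑ) =
          ‖deriv ψ w‖ₑ * (absKernel z w / ‖deriv ψ w‖ₑ) * (‖f (ψ w)‖ₑ * ‖deriv ψ w‖ₑ) by ring,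
        ENNReal.mul_div_cancel (hnd0 w hw) enorm_ne_top]


/-! ### Transfer of the weight -/

/-- The box is the open disk intersected with the compact image of a rectangle in polar coordinates;
`s ≤ 1` keeps the radii of the rectangle nonnegative. -/
theorem measurableSet_carlesonBox (θ₀ : ℝ) {s : ℝ} (hs : s ≤ 1) :
    MeasurableSet (carlesonBox θ₀ s) := by
  have hK : IsCompact ((fun q : ℝ × ℝ => (q.1 : ℂ) * Complex.exp (q.2 * Complex.I)) ''
      (Icc (1 - s) 1 ×ˢ Icc (θ₀ - Real.pi * s) (θ₀ + Real.pi * s))) :=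
    (isCompact_Icc.prod isCompact_Icc).image (by fun_prop)
  have : carlesonBox θ₀ s = ball 0 1 ∩ ((fun q : ℝ × ℝ => (q.1 : ℂ) * Complex.exp (q.2 * Complex.I)) ''
      (Icc (1 - s) 1 ×ˢ Icc (θ₀ - Real.pi * s) (θ₀ + Real.pi * s))) := by
    have hn : ∀ r θ : ℝ, 0 ≤ r → ‖(r : ℂ) * Complex.exp (θ * Complex.I)‖ = r := fun r θ hr => by
      rw [norm_mul, Complex.norm_exp_ofReal_mul_I, Complex.norm_real, Real.norm_of_nonneg hr, mul_one]
    ext z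
    constructor
    · rintro ⟨h1, r, θ, hr, rfl, h2, h3⟩
      refine ⟨mem_ball_zero_iff.2 h1, (r, θ), ⟨⟨by simp only []; linarith, ?_⟩, ?_⟩, rfl⟩
      · rw [hn r θ hr] at h1; exact h1.le
      · rw [abs_le] at h3
        constructor <;> simp only [] <;> linarith [h3.1, h3.2]
    · rintro ⟨h1, ⟨r, θ⟩, ⟨h2, h3⟩, rfl⟩
      refine ⟨mem_ball_zero_iff.1 h1, r, θ, by linarith [h2.1], rfl, by linarith [h2.1], ?_⟩
      rw [abs_le]
      constructor <;> linarith [h3.1, h3.2]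
  rw [this]
  exact measurableSet_ball.inter hK.measurableSet

/-- The weight on the disk that corresponds to `σ` under the unitary `f ↦ (f ∘ ψ) ψ'`. -/
def diskWeight (ψ : ℂ → ℂ) (p : ℝ) (σ : ℂ → ℝ) (z : ℂ) : ℝ≥0∞ :=
  open scoped Classical in
  -- The value `1` off the disk keeps the weight nonzero and finite everywhere once it is so on the
  -- disk.
  if z ∈ ball (0 : ℂ) 1 then ENNReal.ofReal (σ (ψ z)) * ‖deriv ψ z‖ₑ ^ (2 - p) else 1

theorem diskWeight_of_mem {ψ : ℂ → ℂ} {p : ℝ} {σ : ℂ → ℝ} {z : ℂ} (hz : z ∈ ball (0 : ℂ) 1) :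
    diskWeight ψ p σ z = ENNReal.ofReal (σ (ψ z)) * ‖deriv ψ z‖ₑ ^ (2 - p) := if_pos hz

theorem bekolleProduct_one {J : ℂ → ℝ} {E : Set ℂ} :
    bekolleProduct 1 J E = (∫⁻ z in E, ‖J z‖ₑ) / volume E *
      eLpNorm (fun z => (J z)⁻¹) ⊤ (volume.restrict E) := by
  simp [bekolleProduct, localAverage, eLpNorm_one_eq_lintegral_enorm]

theorem bekolleProduct_eq {p : ℝ} (hp : 1 < p) {σ : ℂ → ℝ} (hσ : ∀ z, 0 < σ z) {E : Set ℂ} :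
    bekolleProduct p σ E = (∫⁻ z in E, ENNReal.ofReal (σ z)) / volume E *
      ((∫⁻ z in E, ENNReal.ofReal (σ z) ^ (-(1 / (p - 1)))) ^ (p - 1) / volume E ^ (p - 1)) := by
  have hp1 : 0 < p - 1 := by linarith
  have hq : ((ENNReal.ofReal (p - 1))⁻¹).toReal = 1 / (p - 1) := by
    rw [ENNReal.toReal_inv, ENNReal.toReal_ofReal hp1.le, one_div]
  have hσe : ∀ z, ‖σ z‖ₑ = ENNReal.ofReal (σ z) := fun z => Real.enorm_of_nonneg (hσ z).le
  rw [bekolleProduct, localAverage, localAverage, eLpNorm_one_eq_lintegral_enorm, hq,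
    eLpNorm_eq_lintegral_rpow_enorm_toReal (by simp) (by simp [hp]), hq, one_div_one_div]
  simp only [ENNReal.toReal_one, div_one, ENNReal.rpow_one]
  congr 4
  · simp_rw [hσe]
  · refine funext fun z => ?_
    rw [enorm_inv (hσ z).ne', hσe, ← ENNReal.rpow_neg_one, ← ENNReal.rpow_mul]
    congr 1; ring

/-- After the change of variables, `ω` and its dual weight carry extra factors `(|ψ'|⁻²)^(p/2)` and
`(|ψ'|⁻²)^(p/(2(p-1)))`. Bounding `|ψ'|⁻²` by `κ` yields `κ^p` in the product, and `κ` times the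
average `|ψ(E)| / |E|` of `|ψ'|²` is the `B_1` product. -/
theorem weight_product_le {ψ : ℂ → ℂ} {Ω : Set ℂ} (h : IsConformalOnto ψ Ω)
    (hd : ∀ z ∈ ball (0 : ℂ) 1, deriv ψ z ≠ 0) (hΩ : volume Ω ≠ ⊤) {p : ℝ} (hp : 1 < p)
    {σ : ℂ → ℝ} (hσ : ∀ z, 0 < σ z) {E : Set ℂ} (hEm : MeasurableSet E) (hE : E ⊆ ball 0 1) :
    (∫⁻ z in E, diskWeight ψ p σ z) * (∫⁻ z in E, diskWeight ψ p σ z ^ (-(1 / (p - 1)))) ^ (p - 1) ≤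
      bekolleProduct 1 (fun z => ‖deriv ψ z‖ ^ 2) E ^ p * bekolleProduct p σ (ψ '' E) *
        volume E ^ p := by
  have hp0 : 0 < p := by linarith
  have hp1 : 0 < p - 1 := by linarith
  by_cases hV0 : volume E = 0
  · rw [setLIntegral_measure_zero _ _ hV0]; simp
  have hVt : volume E ≠ ⊤ := ne_top_of_le_ne_top measure_ball_lt_top.ne (measure_mono hE)
  set J : ℂ → ℝ := fun z => ‖deriv ψ z‖ ^ 2 with hJ
  set κ := eLpNorm (fun z => (J z)⁻¹) ⊤ (volume.restrict E) with hκ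
  set V := volume E with hV
  set U := volume (ψ '' E) with hU
  have hJe : ∀ z, ‖J z‖ₑ = ENNReal.ofReal (‖deriv ψ z‖ ^ 2) := fun z =>
    Real.enorm_of_nonneg (sq_nonneg _)
  have hJn : ∀ z, ENNReal.ofReal (‖deriv ψ z‖ ^ 2) = ‖deriv ψ z‖ₑ ^ (2 : ℝ) := fun z => by
    rw [ENNReal.ofReal_pow (norm_nonneg _), ofReal_norm, ENNReal.rpow_ofNat]
  have hUJ : ∫⁻ z in E, ‖J z‖ₑ = U := by
    have := h.lintegral_image hEm hE 1
    simp only [Pi.one_apply, mul_one, setLIntegral_one] at this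
    simp_rw [hJe, hU, this]
  have hUt : U ≠ ⊤ := ne_top_of_le_ne_top hΩ
    (measure_mono ((image_mono hE).trans h.2.image_eq.subset))
  have hU0 : U ≠ 0 := by
    rw [← hUJ]
    intro h0
    have hJm : AEMeasurable (fun z => ‖J z‖ₑ) (volume.restrict E) :=
      (((measurable_deriv ψ).norm.pow_const 2).enorm).aemeasurable
    rw [lintegral_eq_zero_iff' hJm] at h0
    have h1 : ∀ᵐ z ∂volume.restrict E, False := by
      filter_upwards [h0, ae_restrict_mem hEm] with z h2 h3
      have := hd z (hE h3)
      simp [hJ, this] at h2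
    rw [ae_iff] at h1
    simp at h1
    exact hV0 h1
  have hj0 : ∀ z ∈ E, ‖deriv ψ z‖ₑ ≠ 0 := fun z hz => by simpa using hd z (hE hz)
  have hκae : ∀ᵐ z ∂volume.restrict E, ‖deriv ψ z‖ₑ ^ (-2 : ℝ) ≤ κ := by
    have : ∀ᵐ z ∂volume.restrict E, ‖(J z)⁻¹‖ₑ ≤ κ := by
      rw [hκ, eLpNorm_exponent_top]; exact ae_le_eLpNormEssSup
    filter_upwards [this, ae_restrict_mem hEm] with z h1 h2
    rw [enorm_inv (by simpa [hJ] using hd z (hE h2)), hJe, hJn, ← ENNReal.rpow_neg] at h1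
    exact h1
  have key : ∀ (g : ℂ → ℝ≥0∞) (t : ℝ), 0 ≤ t →
      ∫⁻ z in E, g (ψ z) * ‖deriv ψ z‖ₑ ^ (2 - 2 * t) ≤ κ ^ t * ∫⁻ w in ψ '' E, g w := by
    intro g t ht
    rw [h.lintegral_image hEm hE]
    -- For infinite `κ ^ t` the right side is `⊤` unless the second integral vanishes, by `⊤ * 0 =
    -- 0`. In that case the left integral vanishes too, which is checked on a measurable minorant
    -- because `g` is arbitrary.
    by_cases hκt : κ ^ t = ⊤
    · rw [hκt]
      by_cases h0 : ∫⁻ z in E, ENNReal.ofReal (‖deriv ψ z‖ ^ 2) * g (ψ z) = 0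
      · rw [h0, mul_zero, nonpos_iff_eq_zero]
        obtain ⟨b, hbm, hgb, hb⟩ := exists_measurable_le_lintegral_eq (volume.restrict E)
          fun z => g (ψ z) * ‖deriv ψ z‖ₑ ^ (2 - 2 * t)
        rw [hb, lintegral_eq_zero_iff hbm]
        have h1 : ∫⁻ z in E, ‖deriv ψ z‖ₑ ^ (2 * t) * b z = 0 := by
          refine le_antisymm ((setLIntegral_mono_ae' hEm (ae_of_all _ fun z hz => ?_)).trans h0.le)
            zero_le
          calc ‖deriv ψ z‖ₑ ^ (2 * t) * b z ≤
              ‖deriv ψ z‖ₑ ^ (2 * t) * (g (ψ z) * ‖deriv ψ z‖ₑ ^ (2 - 2 * t)) := by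
                gcongr; exact hgb z
            _ = _ := by
                rw [hJn, show (2 : ℝ) = 2 * t + (2 - 2 * t) by ring,
                  ENNReal.rpow_add _ _ (hj0 z hz) enorm_ne_top]
                ring_nf
        rw [lintegral_eq_zero_iff (by have := measurable_deriv ψ; fun_prop)] at h1
        filter_upwards [h1, ae_restrict_mem hEm] with z h2 h3
        have := hj0 z h3
        simpa [this] using h2
      · rw [ENNReal.top_mul h0]; exact le_top
    · rw [← lintegral_const_mul' _ _ hκt]
      refine lintegral_mono_ae ?_
      filter_upwards [hκae, ae_restrict_mem hEm] with z h1 h2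
      rw [hJn, show 2 - 2 * t = 2 + -2 * t by ring,
        ENNReal.rpow_add _ _ (hj0 z h2) enorm_ne_top, ENNReal.rpow_mul]
      calc _ ≤ g (ψ z) * (‖deriv ψ z‖ₑ ^ (2 : ℝ) * κ ^ t) := by gcongr
        _ = _ := by ring
  set A := ∫⁻ w in ψ '' E, ENNReal.ofReal (σ w) with hA
  set A' := ∫⁻ w in ψ '' E, ENNReal.ofReal (σ w) ^ (-(1 / (p - 1))) with hA'
  have h1 : ∫⁻ z in E, diskWeight ψ p σ z ≤ κ ^ (p / 2) * A := by
    refine le_trans (le_of_eq ?_) (key (fun w => ENNReal.ofReal (σ w)) (p / 2) (by positivity))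
    refine setLIntegral_congr_fun hEm fun z hz => ?_
    rw [diskWeight_of_mem (hE hz), show 2 - 2 * (p / 2) = 2 - p by ring]
  have h2 : ∫⁻ z in E, diskWeight ψ p σ z ^ (-(1 / (p - 1))) ≤ κ ^ (p / 2 * (1 / (p - 1))) * A' := by
    refine le_trans (le_of_eq ?_) (key (fun w => ENNReal.ofReal (σ w) ^ (-(1 / (p - 1))))
      (p / 2 * (1 / (p - 1))) (by positivity))
    refine setLIntegral_congr_fun hEm fun z hz => ?_
    rw [diskWeight_of_mem (hE hz), ENNReal.mul_rpow_of_ne_top ENNReal.ofReal_ne_top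
      (ENNReal.rpow_ne_top_of_ne_zero (hj0 z hz) enorm_ne_top), ← ENNReal.rpow_mul]
    congr 2
    field_simp; ring
  have hb1 : bekolleProduct 1 J E = U / V * κ := by rw [bekolleProduct_one, hUJ]
  have hb2 : bekolleProduct p σ (ψ '' E) = A / U * (A' ^ (p - 1) / U ^ (p - 1)) :=
    bekolleProduct_eq hp hσ
  rw [hb1, hb2]
  calc _ ≤ (κ ^ (p / 2) * A) * (κ ^ (p / 2 * (1 / (p - 1))) * A') ^ (p - 1) := by gcongr
    _ = κ ^ p * (A * A' ^ (p - 1)) := by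
        rw [ENNReal.mul_rpow_of_nonneg _ _ hp1.le, ← ENNReal.rpow_mul,
          show p / 2 * (1 / (p - 1)) * (p - 1) = p / 2 by field_simp]
        conv_rhs => rw [show p = p / 2 + p / 2 by ring,
          ENNReal.rpow_add_of_nonneg _ _ (by positivity) (by positivity),
          show p / 2 + p / 2 = p by ring]
        ring
    _ = _ := by
        rw [ENNReal.mul_rpow_of_nonneg _ _ hp0.le, ENNReal.div_rpow_of_nonneg _ _ hp0.le]
        have e1 : U ^ p = U * U ^ (p - 1) := by
          conv_lhs => rw [show p = 1 + (p - 1) by ring]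
          rw [ENNReal.rpow_add _ _ hU0 hUt, ENNReal.rpow_one]
        have c1 : U ^ p * (U⁻¹ * (U ^ (p - 1))⁻¹) = 1 := by
          rw [e1, mul_mul_mul_comm, ENNReal.mul_inv_cancel hU0 hUt, one_mul,
            ENNReal.mul_inv_cancel (by simp [hU0, hUt]) (ENNReal.rpow_ne_top_of_nonneg hp1.le hUt)]
        have c2 : V ^ p * (V ^ p)⁻¹ = 1 :=
          ENNReal.mul_inv_cancel (by simp [hV0, hVt]) (ENNReal.rpow_ne_top_of_nonneg hp0.le hVt)
        simp only [div_eq_mul_inv]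
        calc _ = κ ^ p * (A * A' ^ (p - 1)) * (U ^ p * (U⁻¹ * (U ^ (p - 1))⁻¹)) *
              (V ^ p * (V ^ p)⁻¹) := by rw [c1, c2, mul_one, mul_one]
          _ = _ := by ring

theorem domainChar_congr {ψ : ℂ → ℂ} {Ω : Set ℂ} (h : IsConformalOnto ψ Ω) {p : ℝ} {σ σ' : ℂ → ℝ}
    (hσ : σ =ᵐ[volume.restrict Ω] σ') : domainChar ψ p σ = domainChar ψ p σ' := by
  have key : ∀ E ⊆ ball (0 : ℂ) 1, bekolleProduct p σ (ψ '' E) = bekolleProduct p σ' (ψ '' E) := by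
    intro E hE
    have h1 : σ =ᵐ[volume.restrict (ψ '' E)] σ' :=
      ae_restrict_of_ae_restrict_of_subset ((image_mono hE).trans h.2.image_eq.subset) hσ
    simp only [bekolleProduct, localAverage]
    rw [eLpNorm_congr_ae h1, eLpNorm_congr_ae (show (fun z => (σ z)⁻¹) =ᵐ[_] fun z => (σ' z)⁻¹ from
      h1.fun_comp (·⁻¹))]
  simp only [domainChar, key _ (carlesonBox_subset_ball _ _)]


theorem weightedMeasure_congr {Ω : Set ℂ} {σ σ' : ℂ → ℝ} (hσ : σ =ᵐ[volume.restrict Ω] σ') :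
    weightedMeasure Ω σ = weightedMeasure Ω σ' :=
  withDensity_congr_ae (hσ.fun_comp ENNReal.ofReal)

theorem measurable_diskWeight {ψ : ℂ → ℂ} (hψ : ContinuousOn ψ (ball 0 1)) (p : ℝ) {σ : ℂ → ℝ}
    (hσ : Measurable σ) : Measurable (diskWeight ψ p σ) := by
  classical
  have hψm : Measurable ((ball 0 1).piecewise ψ 0) :=
    hψ.measurable_piecewise continuousOn_const measurableSet_ball
  have hg : Measurable fun z => ENNReal.ofReal (σ ((ball 0 1).piecewise ψ 0 z)) *
      ‖deriv ψ z‖ₑ ^ (2 - p) := by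
    have := measurable_deriv ψ
    fun_prop
  have e : diskWeight ψ p σ = (ball 0 1).piecewise (fun z =>
      ENNReal.ofReal (σ ((ball 0 1).piecewise ψ 0 z)) * ‖deriv ψ z‖ₑ ^ (2 - p)) 1 := by
    ext z
    by_cases hz : z ∈ ball (0 : ℂ) 1
    · rw [diskWeight_of_mem hz, piecewise_eq_of_mem _ _ _ hz, piecewise_eq_of_mem _ _ _ hz]
    · rw [diskWeight, if_neg hz, piecewise_eq_of_notMem _ _ _ hz]; rfl
  rw [e]
  exact hg.piecewise measurableSet_ball measurable_const

/-- The power of `|ψ'|` in `ω` is chosen for this isometry: the Jacobian splits as `|ψ'|² = |ψ'|^p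
|ψ'|^(2-p)`. -/
theorem eLpNorm_weightedMeasure {ψ : ℂ → ℂ} {Ω : Set ℂ} (h : IsConformalOnto ψ Ω)
    (hd : ∀ z ∈ ball (0 : ℂ) 1, deriv ψ z ≠ 0) {p : ℝ} (hp : 1 < p) {σ : ℂ → ℝ}
    (hσ : Measurable σ) (g : ℂ → ℂ) :
    eLpNorm g (ENNReal.ofReal p) (weightedMeasure Ω σ) =
      (∫⁻ z in ball 0 1, (‖g (ψ z)‖ₑ * ‖deriv ψ z‖ₑ) ^ p * diskWeight ψ p σ z) ^ (1 / p) := by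
  have hp0 : 0 < p := by linarith
  rw [eLpNorm_eq_lintegral_rpow_enorm_toReal (by simp [hp0]) ENNReal.ofReal_ne_top,
    ENNReal.toReal_ofReal hp0.le, weightedMeasure,
    lintegral_withDensity_eq_lintegral_mul_non_measurable _ hσ.ennreal_ofReal
      (ae_of_all _ fun _ => ENNReal.ofReal_lt_top), h.lintegral_eq]
  congr 1
  refine setLIntegral_congr_fun measurableSet_ball fun z hz => ?_
  have hj0 : ‖deriv ψ z‖ₑ ≠ 0 := by simpa using hd z hz
  rw [Pi.mul_apply, diskWeight_of_mem hz, ENNReal.mul_rpow_of_nonneg _ _ hp0.le,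
    ENNReal.ofReal_pow (norm_nonneg _), ofReal_norm, ← ENNReal.rpow_ofNat,
    show (OfNat.ofNat 2 : ℝ) = p + (2 - p) by ring, ENNReal.rpow_add _ _ hj0 enorm_ne_top]
  rw [show p + (2 - p) - p = 2 - p by ring]
  ring

/-- The a priori estimate for every `f` in `L²(Ω)`: `weight_product_le` supplies the hypothesis of
the disk estimate, and the pointwise domination and the isometry transport its conclusion to `Ω`. -/
theorem exists_eLpNorm_bergmanProjection_le {p : ℝ} (hp : 1 < p) :
    ∃ C : ℝ≥0∞, C ≠ ⊤ ∧ ∀ (Ω : TopologicalSpace.Opens ℂ) (ψ : ℂ → ℂ) (σ : ℂ → ℝ),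
      Bornology.IsBounded (Ω : Set ℂ) → IsConformalOnto ψ Ω →
      diskChar 1 (fun z => ‖deriv ψ z‖ ^ 2) < ⊤ → IsWeight Ω σ → domainChar ψ p σ < ⊤ →
      ∀ (f : ℂ → ℂ) (hf : MemLp f 2 (volume.restrict (Ω : Set ℂ))),
        eLpNorm (bergmanProjection Ω (hf.toLp f)) (ENNReal.ofReal p) (weightedMeasure Ω σ) ≤
          C * (diskChar 1 (fun z => ‖deriv ψ z‖ ^ 2) ^ p * domainChar ψ p σ) ^
            max 1 (1 / (p - 1)) * eLpNorm f (ENNReal.ofReal p) (weightedMeasure Ω σ) := by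
  have hp0 : 0 < p := by linarith
  obtain ⟨C, hC, hest⟩ := exists_disk_estimate (Real.HolderConjugate.conjExponent hp)
  refine ⟨C, hC, fun Ω ψ σ hΩ h hJ hσ hσc f hf => ?_⟩
  have hd : ∀ z ∈ ball (0 : ℂ) 1, deriv ψ z ≠ 0 := fun z hz => h.deriv_ne_zero hJ hz
  -- All quantities depend only on the class of `σ`, so it may be replaced by a Borel function that
  -- is positive everywhere.
  obtain ⟨τ, hτm, hτ0, hστ⟩ : ∃ τ : ℂ → ℝ, Measurable τ ∧ (∀ z, 0 < τ z) ∧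
      σ =ᵐ[volume.restrict (Ω : Set ℂ)] τ := by
    have hσm : AEStronglyMeasurable σ (volume.restrict (Ω : Set ℂ)) := hσ.1.aestronglyMeasurable
    classical
    have hmk := hσm.stronglyMeasurable_mk.measurable
    refine ⟨fun z => if 0 < hσm.mk σ z then hσm.mk σ z else 1,
      Measurable.ite (measurableSet_lt measurable_const hmk) hmk measurable_const, fun z => ?_, ?_⟩
    · dsimp only
      split_ifs with h0
      · exact h0
      · exact one_pos
    · filter_upwards [hσm.ae_eq_mk, hσ.2] with z h1 h2
      rw [← h1, if_pos h2]
  rw [weightedMeasure_congr hστ, domainChar_congr h hστ] at *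
  set B := diskChar 1 (fun z => ‖deriv ψ z‖ ^ 2) ^ p * domainChar ψ p τ with hB
  have hBt : B ≠ ⊤ :=
    ENNReal.mul_ne_top (ENNReal.rpow_ne_top_of_nonneg hp0.le hJ.ne) hσc.ne
  obtain ⟨g, hg, hfg⟩ : bergmanProjection Ω (hf.toLp f) ∈ bergmanSpace Ω :=
    Submodule.starProjection_apply_mem _ _
  set f' := hf.1.mk f with hf'
  have hff' : f =ᵐ[volume.restrict (Ω : Set ℂ)] f' := hf.1.ae_eq_mk
  have hf'L : MemLp f' 2 (volume.restrict (Ω : Set ℂ)) := (memLp_congr_ae hff').1 hf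
  have hfg' : bergmanProjection Ω (hf'L.toLp f') =ᵐ[volume.restrict (Ω : Set ℂ)] g := by
    rwa [← (MemLp.toLp_eq_toLp_iff hf hf'L).2 hff']
  have hac : weightedMeasure (Ω : Set ℂ) τ ≪ volume.restrict (Ω : Set ℂ) :=
    withDensity_absolutelyContinuous _ _
  rw [eLpNorm_congr_ae (hac.ae_eq hfg), eLpNorm_congr_ae (hac.ae_eq hff'),
    eLpNorm_weightedMeasure h hd hp hτm, eLpNorm_weightedMeasure h hd hp hτm]
  classical
  have hψm : Measurable ((ball 0 1).piecewise ψ 0) :=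
    h.1.continuousOn.measurable_piecewise continuousOn_const measurableSet_ball
  have hψe : ∀ z ∈ ball (0 : ℂ) 1, (ball 0 1).piecewise ψ 0 z = ψ z := fun z hz =>
    piecewise_eq_of_mem _ _ _ hz
  set F : ℂ → ℝ≥0∞ := fun w => ‖f' ((ball 0 1).piecewise ψ 0 w)‖ₑ * ‖deriv ψ w‖ₑ with hF
  have hFm : Measurable F := by
    have h1 := measurable_deriv ψ
    have h2 : Measurable f' := hf.1.stronglyMeasurable_mk.measurable
    fun_prop
  have hFe : ∀ z ∈ ball (0 : ℂ) 1, F z = ‖f' (ψ z)‖ₑ * ‖deriv ψ z‖ₑ := fun z hz => by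
    simp only [hF]; rw [hψe z hz]
  have hVΩ : volume (Ω : Set ℂ) ≠ ⊤ := hΩ.measure_lt_top.ne
  have hω0 : ∀ z, diskWeight ψ p τ z ≠ 0 ∧ diskWeight ψ p τ z ≠ ⊤ := by
    intro z
    by_cases hz : z ∈ ball (0 : ℂ) 1
    · have hj0 : ‖deriv ψ z‖ₑ ≠ 0 := by simpa using hd z hz
      rw [diskWeight_of_mem hz]
      have h1 : ENNReal.ofReal (τ (ψ z)) ≠ 0 := by simp [hτ0]
      exact ⟨mul_ne_zero h1 (by simp [hd z hz]),
        ENNReal.mul_ne_top ENNReal.ofReal_ne_top (ENNReal.rpow_ne_top_of_ne_zero hj0 enorm_ne_top)⟩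
    · rw [diskWeight, if_neg hz]; simp
  have hmain := hest (diskWeight ψ p τ) B (measurable_diskWeight h.1.continuousOn p hτm)
    (fun z => (hω0 z).1) (fun z => (hω0 z).2) hBt (fun θ s hs0 hs1 => by
      refine (weight_product_le h hd hVΩ hp hτ0 (measurableSet_carlesonBox θ hs1)
        (carlesonBox_subset_ball θ s)).trans ?_
      refine mul_le_mul_left (mul_le_mul' (ENNReal.rpow_le_rpow ?_ hp0.le) ?_) _
      · exact le_iSup_of_le (f := fun θ₀ => ⨆ (s : ℝ) (_ : 0 < s ∧ s ≤ 1), _) θ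
          (le_iSup_of_le s (le_iSup_of_le ⟨hs0, hs1⟩ le_rfl))
      · exact le_iSup_of_le (f := fun θ₀ => ⨆ (s : ℝ) (_ : 0 < s ∧ s ≤ 1), _) θ
          (le_iSup_of_le s (le_iSup_of_le ⟨hs0, hs1⟩ le_rfl))) F hFm
  calc _ ≤ (∫⁻ z in ball 0 1, (∫⁻ w in ball 0 1, absKernel z w * F w) ^ p *
        diskWeight ψ p τ z) ^ (1 / p) := by
        refine ENNReal.rpow_le_rpow (setLIntegral_mono_ae' measurableSet_ball
          (ae_of_all _ fun z hz => ?_)) (by positivity)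
        gcongr
        refine (enorm_bergmanProjection_le h hd hf'L hg hfg' hz).trans (le_of_eq ?_)
        exact setLIntegral_congr_fun measurableSet_ball fun w hw => by rw [hFe w hw]
    _ ≤ _ := hmain
    _ = _ := by
        congr 2
        exact setLIntegral_congr_fun measurableSet_ball fun w hw => by rw [hFe w hw]

/-! ### Extension to `L^p(Ω, σ)` -/

/-- As `Ω` has finite area, simple functions lie in both spaces. Hence `L² ∩ L^p(σ)` is dense in
`L^p(σ)`, which gives both existence and uniqueness of the extension. -/
theorem exists_extendsBergman (Ω : TopologicalSpace.Opens ℂ)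
    (hΩ : volume (Ω : Set ℂ) ≠ ⊤) (p : ℝ≥0∞) [Fact (1 ≤ p)] (hp : p ≠ ⊤) {σ : ℂ → ℝ}
    (hσ : IsWeight Ω σ) {K : ℝ≥0∞} (hK : K ≠ ⊤)
    (hb : ∀ (f : ℂ → ℂ) (hf : MemLp f 2 (volume.restrict (Ω : Set ℂ))),
      eLpNorm (bergmanProjection Ω (hf.toLp f)) p (weightedMeasure Ω σ) ≤
        K * eLpNorm f p (weightedMeasure Ω σ)) :
    ∃ T : Lp ℂ p (weightedMeasure Ω σ) →L[ℂ] Lp ℂ p (weightedMeasure Ω σ),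
      ExtendsBergman Ω p σ T ∧ (∀ T', ExtendsBergman Ω p σ T' → T' = T) ∧ ‖T‖ ≤ K.toReal := by
  set μ := volume.restrict (Ω : Set ℂ) with hμ
  set ν := weightedMeasure Ω σ with hν
  have hνμ : ν ≪ μ := withDensity_absolutelyContinuous _ _
  have hσm : AEMeasurable σ μ := hσ.1.aestronglyMeasurable.aemeasurable
  -- Positivity of `σ` almost everywhere makes `μ` and `ν` equivalent, so almost-everywhere classes
  -- can be moved between the two spaces.
  have hμν : μ ≪ ν := withDensity_absolutelyContinuous' hσm.ennreal_ofReal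
    (hσ.2.mono fun z hz => by simpa using hz)
  have : IsFiniteMeasure μ := ⟨by rw [hμ, Measure.restrict_apply_univ]; exact hΩ.lt_top⟩
  let E : Submodule ℂ (Lp ℂ p ν) :=
    { carrier := {F | MemLp F 2 μ}
      zero_mem' := (memLp_congr_ae (hμν.ae_eq (Lp.coeFn_zero ℂ p ν))).2 MemLp.zero
      add_mem' := fun {F G} hF hG =>
        (memLp_congr_ae (hμν.ae_eq (Lp.coeFn_add F G))).2 (hF.add hG)
      smul_mem' := fun c F hF =>
        (memLp_congr_ae (hμν.ae_eq (Lp.coeFn_smul c F))).2 (hF.const_smul c) }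
  have hmem : ∀ F : Lp ℂ p ν, ∀ hF : MemLp F 2 μ, MemLp (bergmanProjection Ω (hF.toLp F)) p ν :=
    fun F hF => ⟨(Lp.aestronglyMeasurable _).mono_ac hνμ,
      (hb F hF).trans_lt (ENNReal.mul_lt_top hK.lt_top (Lp.memLp F).2)⟩
  let T₀ : E →ₗ[ℂ] Lp ℂ p ν :=
    { toFun := fun F => (hmem F.1 F.2).toLp _
      map_add' := by
        rintro ⟨F, hF⟩ ⟨G, hG⟩
        have e : MemLp.toLp (F + G : Lp ℂ p ν) (E.add_mem hF hG) = hF.toLp F + hG.toLp G := by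
          rw [← MemLp.toLp_add, MemLp.toLp_eq_toLp_iff]
          exact hμν.ae_eq (Lp.coeFn_add F G)
        rw [← MemLp.toLp_add, MemLp.toLp_eq_toLp_iff]
        refine hνμ.ae_eq ?_
        change bergmanProjection Ω (MemLp.toLp (F + G : Lp ℂ p ν) (E.add_mem hF hG)) =ᵐ[μ] _
        rw [e, map_add]
        exact Lp.coeFn_add _ _
      map_smul' := by
        rintro c ⟨F, hF⟩
        have e : MemLp.toLp (c • F : Lp ℂ p ν) (E.smul_mem c hF) = c • hF.toLp F := by
          rw [← MemLp.toLp_const_smul, MemLp.toLp_eq_toLp_iff]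
          exact hμν.ae_eq (Lp.coeFn_smul c F)
        rw [RingHom.id_apply, ← MemLp.toLp_const_smul, MemLp.toLp_eq_toLp_iff]
        refine hνμ.ae_eq ?_
        change bergmanProjection Ω (MemLp.toLp (c • F : Lp ℂ p ν) (E.smul_mem c hF)) =ᵐ[μ] _
        rw [e, map_smul]
        exact Lp.coeFn_smul _ _ }
  have hnorm : ∀ F : E, ‖T₀ F‖ ≤ K.toReal * ‖E.subtype F‖ := by
    rintro ⟨F, hF⟩
    change ‖(hmem F hF).toLp _‖ ≤ K.toReal * ‖F‖
    rw [Lp.norm_toLp, Lp.norm_def, ← ENNReal.toReal_mul]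
    exact ENNReal.toReal_mono (ENNReal.mul_ne_top hK (Lp.memLp F).2.ne) (hb F hF)
  have hdense : DenseRange E.subtype := by
    refine (Lp.simpleFunc.dense (E := ℂ) (μ := ν) hp).mono ?_
    intro F hF
    obtain ⟨s, hs⟩ : ∃ s : SimpleFunc ℂ ℂ, (AEEqFun.mk s s.aestronglyMeasurable : ℂ →ₘ[ν] ℂ) = F := hF
    have hsF : F =ᵐ[ν] s := by
      have := AEEqFun.coeFn_mk s (s.aestronglyMeasurable (μ := ν))
      rwa [hs] at this
    refine ⟨⟨F, (memLp_congr_ae (hμν.ae_eq hsF)).2 ?_⟩, rfl⟩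
    exact s.memLp_of_isFiniteMeasure 2 μ
  have hext : ∀ (F : Lp ℂ p ν) (hF : MemLp F 2 μ),
      T₀.extendOfNorm E.subtype F =ᵐ[μ] bergmanProjection Ω (hF.toLp F) := by
    intro F hF
    have h1 := LinearMap.extendOfNorm_eq hdense ⟨_, hnorm⟩ ⟨F, hF⟩
    change T₀.extendOfNorm E.subtype F = (hmem F hF).toLp _ at h1
    rw [h1]
    exact hμν.ae_eq (MemLp.coeFn_toLp _)
  refine ⟨T₀.extendOfNorm E.subtype, ?_, ?_, ?_⟩
  · intro f h₂ hfp
    have hfe : hfp.toLp f =ᵐ[μ] f := hμν.ae_eq hfp.coeFn_toLp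
    have hF : MemLp (hfp.toLp f) 2 μ := (memLp_congr_ae hfe).2 h₂
    have h1 := hext _ hF
    rwa [(MemLp.toLp_eq_toLp_iff hF h₂).2 hfe] at h1
  · intro T' hT'
    refine (LinearMap.extendOfNorm_unique hdense K.toReal hnorm T' ?_).symm
    ext1 ⟨F, hF⟩
    change T' F = (hmem F hF).toLp _
    have h1 := hT' F hF (Lp.memLp F)
    rw [Lp.toLp_coeFn] at h1
    refine Lp.ext ((hνμ.ae_eq h1).trans ?_)
    exact (MemLp.coeFn_toLp (hmem F hF)).symm
  · refine ContinuousLinearMap.opNorm_le_bound _ ENNReal.toReal_nonneg fun F => ?_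
    exact LinearMap.norm_extendOfNorm_apply_le hdense _ hnorm F

end Bekolle

end

/-! ### The weighted bound on `Ω`. -/

theorem theorem1p1 (p : ℝ) (hp : 1 < p) [Fact (1 ≤ ENNReal.ofReal p)] :
    ∃ C : ℝ, 0 < C ∧
      ∀ (Ω : TopologicalSpace.Opens ℂ) (ψ : ℂ → ℂ) (σ : ℂ → ℝ),
        Bornology.IsBounded (Ω : Set ℂ) → IsSimplyConnected (Ω : Set ℂ) →
        Bekolle.IsConformalOnto ψ Ω →
        Bekolle.diskChar 1 (fun z => ‖deriv ψ z‖ ^ 2) < ⊤ →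
        Bekolle.IsWeight Ω σ → Bekolle.domainChar ψ p σ < ⊤ →
        ∃ T : Lp ℂ (ENNReal.ofReal p) (Bekolle.weightedMeasure Ω σ) →L[ℂ]
            Lp ℂ (ENNReal.ofReal p) (Bekolle.weightedMeasure Ω σ),
          Bekolle.ExtendsBergman Ω (ENNReal.ofReal p) σ T ∧
          (∀ T', Bekolle.ExtendsBergman Ω (ENNReal.ofReal p) σ T' → T' = T) ∧
          ‖T‖ ≤ C * ((Bekolle.diskChar 1 fun z => ‖deriv ψ z‖ ^ 2).toReal ^ p *
            (Bekolle.domainChar ψ p σ).toReal) ^ max 1 (1 / (p - 1)) := by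
  obtain ⟨C, hC, hbound⟩ := Bekolle.exists_eLpNorm_bergmanProjection_le hp
  -- Adding `1` makes the constant strictly positive.
  refine ⟨C.toReal + 1, by positivity, fun Ω ψ σ hΩ _ h hJ hσ hσc => ?_⟩
  have hp0 : 0 < p := by linarith
  have hK : C * (Bekolle.diskChar 1 (fun z => ‖deriv ψ z‖ ^ 2) ^ p * Bekolle.domainChar ψ p σ) ^
      max 1 (1 / (p - 1)) ≠ ⊤ := by
    refine ENNReal.mul_ne_top hC (ENNReal.rpow_ne_top_of_nonneg (by positivity)
      (ENNReal.mul_ne_top (ENNReal.rpow_ne_top_of_nonneg hp0.le hJ.ne) hσc.ne))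
  obtain ⟨T, hT, huniq, hTn⟩ := Bekolle.exists_extendsBergman Ω hΩ.measure_lt_top.ne
    (ENNReal.ofReal p) ENNReal.ofReal_ne_top hσ hK (hbound Ω ψ σ hΩ h hJ hσ hσc)
  refine ⟨T, hT, huniq, hTn.trans ?_⟩
  rw [ENNReal.toReal_mul, ← ENNReal.toReal_rpow, ENNReal.toReal_mul, ← ENNReal.toReal_rpow]
  gcongr
  linarith
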